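/- Let $(P,\mathcal B)$ be an $S(4,7,23)$ Steiner system: $P$ is a set of $23$ points and $\mathcal B$ is a set of $7$-subsets (blocks) of $P$ such that every $4$-subset of $P$ lies in exactly one block. Let $G$ be the automorphism group of $(P,\mathcal B)$, that is, the group of permutations of $P$ that preserve $\mathcal B$ (the Mathieu group $M_{23}$). Let $(\alpha_i)_{i\in P}$ be unit vectors in $\mathbf R^{23}$ with $(\alpha_i,\alpha_j)=1/5$ for all $i\neq j$, for each block $B$ put $$\gamma_B=\frac13\sum_{i\in B}\alpha_i-\frac16\sum_{i\in P\setminus B}\alpha_i ,$$ and let $\mathcal U=\{\alpha_i : i\in P\}\cup\{\gamma_B : B\in\mathcal B\}$. Then $\mathcal U$ consists of $276$ unit vectors, and $|(u,v)|=1/5$ for all distinct $u,v\in\mathcal U$; so $\mathcal U$ represents $276$ equiangular lines in $\mathbf R^{23}$. Let $x\in G$ be an involution (an element of order $2$). There is exactly one linear map of $\mathbf R^{23}$, again denoted by $x$, that sends $\alpha_i$ to $\alpha_{x(i)}$ for every $i\in P$; it maps $\mathcal U$ onto itself. It fixes exactly $36$ elements of $\mathcal U$. Let $\mathcal E$ be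 the set of the remaining $240$ elements of $\mathcal U$, let $W$ be the $(-1)$-eigenspace of $x$, and let $\mathcal E_8$ be the image of $\mathcal E$ under the orthogonal projection onto $W$. Then $\dim W=8$, $|\mathcal E_8|=240$, and there are a real number $c>0$ and a linear isometry from $W$ onto $\mathbf R^8$ that maps $c\,\mathcal E_8$ onto the set of minimal vectors (the nonzero vectors of smallest norm) of the $E_8$ lattice $$\Big\{v\in\mathbf Z^8\cup\big(\mathbf Z+\tfrac12\big)^8 : \sum_{i=1}^8 v_i\in 2\mathbf Z\Big\}.$$ -/

import Mathlib

open scoped RealInnerProductSpace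

/-- Euclidean 23-dimensional space. -/
abbrev R23 : Type := EuclideanSpace ℝ (Fin 23)

/-- Euclidean 8-dimensional space. -/
abbrev R8 : Type := EuclideanSpace ℝ (Fin 8)

/-- `(P, 𝓑)` is a Steiner system `S(t, k, v)`: a set `P` of `v` points with a set `𝓑` of
`k`-subsets of `P` (blocks) such that every `t`-subset of `P` lies in exactly one block. -/
structure IsSteinerSystem {P : Type*} [Fintype P] (t k v : ℕ) (𝓑 : Finset (Finset P)) : Prop where
  card_points : Fintype.card P = v
  card_block : ∀ B ∈ 𝓑, B.card = k
  existsUnique_block : ∀ s : Finset P, s.card = t → ∃! B : Finset P, B ∈ 𝓑 ∧ s ⊆ B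

/-- The automorphism group of `(P, 𝓑)`: the permutations of the points that map blocks to blocks
(and non-blocks to non-blocks). For the Steiner system `S(4, 7, 23)` this is the Mathieu group
`M₂₃` in its natural action. -/
def blockAut {P : Type*} (𝓑 : Finset (Finset P)) : Subgroup (Equiv.Perm P) where
  carrier := {g | ∀ B : Finset P, B.map g.toEmbedding ∈ 𝓑 ↔ B ∈ 𝓑}
  one_mem' := fun B => by
    have h : B.map (1 : Equiv.Perm P).toEmbedding = B := by
      ext a
      simp only [Finset.mem_map_equiv]
      rfl
    rw [h]
  mul_mem' := fun {g h} hg hh B => by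
    have e : B.map (g * h).toEmbedding = (B.map h.toEmbedding).map g.toEmbedding := by
      ext a
      simp only [Finset.mem_map_equiv]
      rfl
    rw [e]
    exact (hg _).trans (hh B)
  inv_mem' := fun {g} hg B => by
    have e : (B.map (g⁻¹).toEmbedding).map g.toEmbedding = B := by
      ext a
      simp only [Finset.mem_map_equiv]
      change g (g.symm a) ∈ B ↔ a ∈ B
      rw [Equiv.apply_symm_apply]
    rw [← hg, e]

/-- The vector `(1/3) ∑_{i ∈ B} αᵢ - (1/6) ∑_{i ∉ B} αᵢ` attached to a block `B`. -/
noncomputable def blockVector {P : Type*} [Fintype P] [DecidableEq P] (α : P → R23)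
    (B : Finset P) : R23 :=
  (1 / 3 : ℝ) • ∑ i ∈ B, α i - (1 / 6 : ℝ) • ∑ i ∈ Bᶜ, α i

/-- The vectors representing the lines: the `αᵢ` together with the block vectors. -/
def lineVectors {P : Type*} [Fintype P] [DecidableEq P] (𝓑 : Finset (Finset P))
    (α : P → R23) : Set R23 :=
  Set.range α ∪ {u | ∃ B ∈ 𝓑, u = blockVector α B}

/-- The `E₈` lattice: the vectors of `ℝ⁸` whose coordinates are all integers or are all integers
plus `1/2`, and whose coordinate sum is an even integer. -/
def latticeE8 : AddSubgroup R8 where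
  carrier := {v | ((∃ z : Fin 8 → ℤ, ∀ i, v i = z i) ∨ (∃ z : Fin 8 → ℤ, ∀ i, v i = z i + 1 / 2)) ∧
    ∃ m : ℤ, ∑ i, v i = 2 * m}
  zero_mem' := ⟨Or.inl ⟨0, by simp⟩, 0, by simp⟩
  add_mem' := by
    rintro a b ⟨ha, m, hm⟩ ⟨hb, n, hn⟩
    refine ⟨?_, m + n, ?_⟩
    · rcases ha with ⟨y, hy⟩ | ⟨y, hy⟩ <;> rcases hb with ⟨z, hz⟩ | ⟨z, hz⟩
      · exact Or.inl ⟨fun i => y i + z i, fun i => by simp [hy, hz]⟩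
      · exact Or.inr ⟨fun i => y i + z i, fun i => by simp [hy, hz]; ring⟩
      · exact Or.inr ⟨fun i => y i + z i, fun i => by simp [hy, hz]; ring⟩
      · exact Or.inl ⟨fun i => y i + z i + 1, fun i => by simp [hy, hz]; ring⟩
    · simp only [PiLp.add_apply, Finset.sum_add_distrib, hm, hn]
      push_cast
      ring
  neg_mem' := by
    rintro a ⟨ha, m, hm⟩
    refine ⟨?_, -m, ?_⟩
    · rcases ha with ⟨y, hy⟩ | ⟨y, hy⟩
      · exact Or.inl ⟨fun i => -y i, fun i => by simp [hy]⟩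
      · exact Or.inr ⟨fun i => -y i - 1, fun i => by simp [hy]; ring⟩
    · simp only [PiLp.neg_apply, Finset.sum_neg_distrib, hm]
      push_cast
      ring

/-- The minimal vectors of a lattice: its nonzero vectors of smallest norm. -/
def minimalVectors {E : Type*} [NormedAddCommGroup E] (L : AddSubgroup E) : Set E :=
  {v | v ∈ L ∧ v ≠ 0 ∧ ∀ w ∈ L, w ≠ 0 → ‖v‖ ≤ ‖w‖}

/-- The elements of `X` not fixed by `T`, projected orthogonally onto the `(-1)`-eigenspace
of `T`. -/
noncomputable def projectedMoved (T : R23 →ₗ[ℝ] R23) (X : Set R23) :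
    Set (Module.End.eigenspace T (-1)) :=
  (Module.End.eigenspace T (-1)).orthogonalProjectionOnto '' {u | u ∈ X ∧ T u ≠ u}

/-! Counting blocks through small point sets shows that distinct blocks meet in 1 or 3 points. With
the Gram matrix (4/5)I + (1/5)J of the αᵢ, all inner products between distinct line vectors are then
±1/5, so the 23 + 253 vectors are distinct.

For an involution x with k two-cycles, sort the blocks B by the numbers of fixed and of moved points
in B ∩ xB. Double counts of fixed pairs, triples and quadruples, and of one or two 2-cycles inside
blocks, force k = 8, 29 fixed blocks and, decisively, |B ∩ xB| = 3 for every moved block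
(`involution_structure`). Hence ⟪u, xu⟫ = +1/5 for every moved u.

The projection of u onto W is (u − xu)/2, so projections have inner products (⟪u, v⟫ − ⟪u, xv⟫)/2.
Both terms are odd multiples of 1/5, so after scaling by √5 the moved vectors acquire squared norm 2
and integral inner products; they also stay distinct. One αᵢ from each 2-cycle projects to an
orthogonal frame of W (`exists_antiProj_orthonormalBasis`), in which the 240 scaled vectors are a/√2
with a integral, of squared norm 4 and with even mutual inner products.

Modulo 2 these a become words of weight 0 or 4 with even intersections, and at most 16 vectors lie
over each word. So at least 14 quadruples occur; they cover every triple of coordinates exactly once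
and, after relabelling, contain generators of the extended Hamming code. This determines the 240
vectors (`exists_perm_image_eq_hammingVectors`). The minimal vectors of E₈ have the same coordinates
in the frame e₂ⱼ ± e₂ⱼ₊₁ (`image_hammingVectors`), and matching the two frames is the isometry. -/

/-! ### Block counts and intersection numbers of S(4, 7, 23). -/

section Counting

variable {P : Type*} [Fintype P] [DecidableEq P] {𝓑 : Finset (Finset P)}

set_option linter.unusedSectionVars false

/-- The number of blocks containing a given set. -/
def blocksThrough (𝓑 : Finset (Finset P)) (S : Finset P) : ℕ := (𝓑.filter (S ⊆ ·)).card

lemma sum_card_subset_eq_sum_blocksThrough {ι : Type*} (t : Finset ι) (g : ι → Finset P) :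
    ∑ B ∈ 𝓑, (t.filter (fun i => g i ⊆ B)).card = ∑ i ∈ t, blocksThrough 𝓑 (g i) := by
  unfold blocksThrough
  exact (Finset.sum_card_bipartiteAbove_eq_sum_card_bipartiteBelow (fun i B => g i ⊆ B)).symm

/-- Count the pairs (i, B) with i ∉ S and S ∪ {i} ⊆ B in two ways. This is the descent from
(j+1)-sets to j-sets that produces 1, 5, 21, 77, 253. -/
lemma mul_blocksThrough_eq (hS : IsSteinerSystem 4 7 23 𝓑) {j l : ℕ}
    (h : ∀ S : Finset P, S.card = j + 1 → blocksThrough 𝓑 S = l) (S : Finset P)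
    (hj : S.card = j) : (7 - j) * blocksThrough 𝓑 S = (23 - j) * l := by
  have h1 := sum_card_subset_eq_sum_blocksThrough (𝓑 := 𝓑) Sᶜ (fun i => insert i S)
  have h2 : ∑ i ∈ Sᶜ, blocksThrough 𝓑 (insert i S) = (23 - j) * l := by
    rw [Finset.sum_const_nat (m := l), Finset.card_compl, hS.card_points, hj]
    intro i hi
    apply h
    rw [Finset.card_insert_of_notMem (Finset.mem_compl.1 hi), hj]
  rw [← h2, ← h1, blocksThrough, Finset.card_filter, Finset.mul_sum]
  apply Finset.sum_congr rfl
  intro B hB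
  split_ifs with hSB
  · have : Sᶜ.filter (fun i => insert i S ⊆ B) = B \ S := by
      ext i
      simp only [Finset.mem_filter, Finset.mem_compl, Finset.insert_subset_iff, Finset.mem_sdiff]
      tauto
    rw [this, Finset.card_sdiff_of_subset hSB, hS.card_block B hB, hj, mul_one]
  · rw [mul_zero, eq_comm, Finset.card_eq_zero, Finset.filter_eq_empty_iff]
    intro i _ hi
    exact hSB ((Finset.subset_insert i S).trans hi)

lemma blocksThrough_of_card_eq_four (hS : IsSteinerSystem 4 7 23 𝓑) (S : Finset P)
    (h : S.card = 4) : blocksThrough 𝓑 S = 1 := by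
  obtain ⟨B, ⟨hB, hSB⟩, hu⟩ := hS.existsUnique_block S h
  rw [blocksThrough, Finset.card_eq_one]
  refine ⟨B, ?_⟩
  ext C
  simp only [Finset.mem_filter, Finset.mem_singleton]
  exact ⟨fun hC => hu C hC, fun hC => hC ▸ ⟨hB, hSB⟩⟩

lemma blocksThrough_of_card_eq_three (hS : IsSteinerSystem 4 7 23 𝓑) (S : Finset P)
    (h : S.card = 3) : blocksThrough 𝓑 S = 5 := by
  have := mul_blocksThrough_eq hS (blocksThrough_of_card_eq_four hS) S h
  omega

lemma blocksThrough_of_card_eq_two (hS : IsSteinerSystem 4 7 23 𝓑) (S : Finset P)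
    (h : S.card = 2) : blocksThrough 𝓑 S = 21 := by
  have := mul_blocksThrough_eq hS (blocksThrough_of_card_eq_three hS) S h
  omega

lemma blocksThrough_of_card_eq_one (hS : IsSteinerSystem 4 7 23 𝓑) (S : Finset P)
    (h : S.card = 1) : blocksThrough 𝓑 S = 77 := by
  have := mul_blocksThrough_eq hS (blocksThrough_of_card_eq_two hS) S h
  omega

lemma card_blocks (hS : IsSteinerSystem 4 7 23 𝓑) : 𝓑.card = 253 := by
  have := mul_blocksThrough_eq hS (blocksThrough_of_card_eq_one hS) ∅ rfl
  rw [blocksThrough, Finset.filter_true_of_mem (fun _ _ => Finset.empty_subset _)] at this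
  omega

/-- Double count of the pairs (S, B) with S a j-subset of F ∩ B: the binomial moments of the
intersection sizes with F. -/
lemma sum_choose_card_inter {j l : ℕ} (h : ∀ S : Finset P, S.card = j → blocksThrough 𝓑 S = l)
    (F : Finset P) : ∑ B ∈ 𝓑, (F ∩ B).card.choose j = F.card.choose j * l := by
  have h1 := sum_card_subset_eq_sum_blocksThrough (𝓑 := 𝓑) (F.powersetCard j) id
  rw [Finset.sum_const_nat (s := F.powersetCard j) (m := l), Finset.card_powersetCard] at h1
  · rw [← h1]
    apply Finset.sum_congr rfl
    intro B _
    rw [← Finset.card_powersetCard]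
    congr 1
    ext S
    simp only [Finset.mem_powersetCard, Finset.subset_inter_iff, Finset.mem_filter, id]
    tauto
  · intro S hS
    exact h S (Finset.mem_powersetCard.1 hS).2

lemma card_inter_le_three (hS : IsSteinerSystem 4 7 23 𝓑) {B C : Finset P} (hB : B ∈ 𝓑)
    (hC : C ∈ 𝓑) (hne : B ≠ C) : (B ∩ C).card ≤ 3 := by
  by_contra! hlt
  obtain ⟨S, hSs, hS4⟩ := Finset.exists_subset_card_eq (show 4 ≤ (B ∩ C).card by omega)
  obtain ⟨h1, h2⟩ := Finset.subset_inter_iff.1 hSs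
  exact hne ((hS.existsUnique_block S hS4).unique ⟨hB, h1⟩ ⟨hC, h2⟩)

/-- Distinct blocks of an `S(4, 7, 23)` meet in one or three points. -/
lemma card_inter_eq_one_or_three (hS : IsSteinerSystem 4 7 23 𝓑) {B C : Finset P} (hB : B ∈ 𝓑)
    (hC : C ∈ 𝓑) (hne : B ≠ C) : (B ∩ C).card = 1 ∨ (B ∩ C).card = 3 := by
  have hmem : ∀ C ∈ 𝓑.erase B, (B ∩ C).card ∈ Finset.range 4 := by
    intro C hC
    obtain ⟨h1, h2⟩ := Finset.mem_erase.1 hC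
    have := card_inter_le_three hS hB h2 (Ne.symm h1)
    exact Finset.mem_range.2 (by omega)
  set N : ℕ → ℕ := fun k => ((𝓑.erase B).filter (fun C => (B ∩ C).card = k)).card with hN
  have key : ∀ f : ℕ → ℕ, ∑ C ∈ 𝓑, f (B ∩ C).card = f 7 + ∑ k ∈ Finset.range 4, N k * f k := by
    intro f
    rw [← Finset.add_sum_erase _ _ hB, Finset.inter_self, hS.card_block B hB,
      ← Finset.sum_fiberwise_of_maps_to' hmem]
    simp [hN]
  have e0 := key (fun k => k.choose 0)
  have e1 := key (fun k => k.choose 1)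
  have e2 := key (fun k => k.choose 2)
  have e3 := key (fun k => k.choose 3)
  rw [sum_choose_card_inter (blocksThrough_of_card_eq_one hS), hS.card_block B hB] at e1
  rw [sum_choose_card_inter (blocksThrough_of_card_eq_two hS), hS.card_block B hB] at e2
  rw [sum_choose_card_inter (blocksThrough_of_card_eq_three hS), hS.card_block B hB] at e3
  simp only [Nat.choose_zero_right, Finset.sum_const, card_blocks hS] at e0
  simp only [Finset.sum_range_succ, Finset.sum_range_zero] at e0 e1 e2 e3
  norm_num [Nat.choose] at e0 e1 e2 e3
  -- The four moment equations are triangular: N 3 = 140, N 2 = 0, N 1 = 112, N 0 = 0.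
  have h0 : N 0 = 0 := by omega
  have h2 : N 2 = 0 := by omega
  have hC' : C ∈ 𝓑.erase B := Finset.mem_erase.2 ⟨Ne.symm hne, hC⟩
  have hle := card_inter_le_three hS hB hC hne
  have n0 : (B ∩ C).card ≠ 0 := fun h =>
    (Finset.card_pos.2 ⟨C, Finset.mem_filter.2 ⟨hC', h⟩⟩).ne' h0
  have n2 : (B ∩ C).card ≠ 2 := fun h =>
    (Finset.card_pos.2 ⟨C, Finset.mem_filter.2 ⟨hC', h⟩⟩).ne' h2
  omega

end Counting

/-! ### Fixed points and fixed blocks of an involution. -/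

section Involution

variable {P : Type*} [Fintype P] [DecidableEq P] {𝓑 : Finset (Finset P)}

set_option linter.unusedSectionVars false

lemma even_card_of_involution {s : Finset P} (f : P → P) (hf : ∀ i, f (f i) = i)
    (hs : ∀ i ∈ s, f i ∈ s) (hne : ∀ i ∈ s, f i ≠ i) : Even s.card := by
  have : ∑ i ∈ s, (1 : ZMod 2) = 0 :=
    Finset.sum_involution (fun i _ => f i) (fun _ _ => by decide) (fun i hi _ => hne i hi)
      (fun i hi => hs i hi) (fun i _ => hf i)
  rw [Finset.sum_const, nsmul_eq_mul, mul_one] at this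
  exact (ZMod.natCast_eq_zero_iff_even).1 this

/-- The fixed points of a permutation inside a set. -/
def fixedIn (x : Equiv.Perm P) (B : Finset P) : Finset P := B.filter (fun i => x i = i)

/-- The points moved by a permutation and remaining in a given set. -/
def movedIn (x : Equiv.Perm P) (B : Finset P) : Finset P :=
  B.filter (fun i => x i ∈ B ∧ x i ≠ i)

lemma fixedIn_eq_inter (x : Equiv.Perm P) (B : Finset P) :
    fixedIn x B = fixedIn x Finset.univ ∩ B := by
  ext i; simp [fixedIn, and_comm]

lemma even_card_movedIn {x : Equiv.Perm P} (hx2 : ∀ i, x (x i) = i) (B : Finset P) :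
    Even (movedIn x B).card := by
  apply even_card_of_involution x hx2
  · intro i hi
    simp only [movedIn, Finset.mem_filter, hx2] at hi ⊢
    exact ⟨hi.2.1, hi.1, Ne.symm hi.2.2⟩
  · intro i hi
    exact (Finset.mem_filter.1 hi).2.2

lemma card_fixedIn_add_card_movedIn_univ (x : Equiv.Perm P) :
    (fixedIn x Finset.univ).card + (movedIn x Finset.univ).card = Fintype.card P := by
  simp only [fixedIn, movedIn, Finset.mem_univ, true_and]
  exact Finset.card_filter_add_card_filter_not _

lemma inter_map_eq {x : Equiv.Perm P} (hx2 : ∀ i, x (x i) = i) (B : Finset P) :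
    B ∩ B.map x.toEmbedding = B.filter (fun i => x i ∈ B) := by
  ext i
  have : x.symm i = x i := by rw [Equiv.symm_apply_eq, hx2]
  simp [Finset.mem_map_equiv, this]

/-- Since x² = 1, B ∩ xB consists of the points of B whose image is again in B; a fixed point of B
is automatically one of them. -/
lemma card_inter_map {x : Equiv.Perm P} (hx2 : ∀ i, x (x i) = i) (B : Finset P) :
    (B ∩ B.map x.toEmbedding).card = (fixedIn x B).card + (movedIn x B).card := by
  rw [inter_map_eq hx2, ← Finset.card_filter_add_card_filter_not (fun i => x i = i),
    Finset.filter_filter, Finset.filter_filter, fixedIn, movedIn]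
  congr 2
  apply Finset.filter_congr
  intro i hi
  exact ⟨fun h => h.2, fun h => ⟨h.symm ▸ hi, h⟩⟩

lemma sum_card_movedIn (hS : IsSteinerSystem 4 7 23 𝓑) (x : Equiv.Perm P) :
    ∑ B ∈ 𝓑, (movedIn x B).card = (movedIn x Finset.univ).card * 21 := by
  have h := sum_card_subset_eq_sum_blocksThrough (𝓑 := 𝓑) (movedIn x Finset.univ)
    (fun i => {i, x i})
  rw [Finset.sum_const_nat (s := movedIn x Finset.univ) (m := 21)] at h
  · rw [← h]
    apply Finset.sum_congr rfl
    intro B _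
    congr 1
    ext i
    simp [movedIn, Finset.insert_subset_iff]
    tauto
  · intro i hi
    apply blocksThrough_of_card_eq_two hS
    exact Finset.card_pair (Ne.symm (Finset.mem_filter.1 hi).2.2)

/-- The ordered pairs of points of `movedIn x B` in different orbits of an involution `x`. -/
def movedPairs (x : Equiv.Perm P) (B : Finset P) : Finset (P × P) :=
  (movedIn x B ×ˢ movedIn x B).filter (fun p => p.2 ≠ p.1 ∧ p.2 ≠ x p.1)

lemma card_movedPairs {x : Equiv.Perm P} (hx2 : ∀ i, x (x i) = i) (B : Finset P) :
    (movedPairs x B).card = (movedIn x B).card * ((movedIn x B).card - 2) := by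
  rw [movedPairs, Finset.card_filter, Finset.sum_product, Finset.sum_const_nat
    (m := (movedIn x B).card - 2)]
  intro i hi
  have hi' := Finset.mem_filter.1 hi
  have hxi : x i ∈ (movedIn x B).erase i := by
    simp only [movedIn, Finset.mem_erase, Finset.mem_filter, hx2]
    exact ⟨hi'.2.2, hi'.2.1, hi'.1, Ne.symm hi'.2.2⟩
  rw [← Finset.card_filter]
  have : (movedIn x B).filter (fun j => j ≠ i ∧ j ≠ x i) = ((movedIn x B).erase i).erase (x i) := by
    ext j; simp only [Finset.mem_filter, Finset.mem_erase]; tauto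
  rw [this, Finset.card_erase_of_mem hxi, Finset.card_erase_of_mem hi]
  omega

/-- Two distinct 2-cycles form a 4-set, which lies in exactly one block. -/
lemma sum_card_movedPairs (hS : IsSteinerSystem 4 7 23 𝓑) {x : Equiv.Perm P}
    (hx2 : ∀ i, x (x i) = i) :
    ∑ B ∈ 𝓑, (movedPairs x B).card = (movedPairs x Finset.univ).card := by
  have h := sum_card_subset_eq_sum_blocksThrough (𝓑 := 𝓑) (movedPairs x Finset.univ)
    (fun p => {p.1, x p.1, p.2, x p.2})
  rw [Finset.sum_const_nat (s := movedPairs x Finset.univ) (m := 1), mul_one] at h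
  · rw [← h]
    apply Finset.sum_congr rfl
    intro B _
    congr 1
    ext p
    simp [movedPairs, movedIn, Finset.insert_subset_iff]
    tauto
  · rintro ⟨i, j⟩ hp
    apply blocksThrough_of_card_eq_four hS
    simp only [movedPairs, movedIn, Finset.mem_filter, Finset.mem_product, Finset.mem_univ,
      true_and] at hp
    obtain ⟨⟨h1, h2⟩, h3, h4⟩ := hp
    have h5 : x i ≠ x j := fun h => h3 (x.injective h).symm
    have h6 : i ≠ x j := fun h => h4 (by rw [h, hx2])
    rw [Finset.card_insert_of_notMem, Finset.card_insert_of_notMem, Finset.card_pair h2.symm] <;>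
      simp [*, Ne.symm h1, Ne.symm h3, Ne.symm h4]

lemma map_mem_of_mem_blockAut {x : Equiv.Perm P} (hx : x ∈ blockAut 𝓑) {B : Finset P}
    (hB : B ∈ 𝓑) : B.map x.toEmbedding ∈ 𝓑 := (hx B).2 hB

lemma card_inter_map_of_mem (hS : IsSteinerSystem 4 7 23 𝓑) {x : Equiv.Perm P}
    (hx : x ∈ blockAut 𝓑) {B : Finset P} (hB : B ∈ 𝓑) :
    (B.map x.toEmbedding = B ∧ (B ∩ B.map x.toEmbedding).card = 7) ∨
    (B.map x.toEmbedding ≠ B ∧ (B ∩ B.map x.toEmbedding).card = 3) ∨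
    (B.map x.toEmbedding ≠ B ∧ (B ∩ B.map x.toEmbedding).card = 1) := by
  by_cases h : B.map x.toEmbedding = B
  · left
    rw [h, Finset.inter_self, hS.card_block B hB]; simp
  · right
    rcases card_inter_eq_one_or_three hS hB (map_mem_of_mem_blockAut hx hB) (Ne.symm h) with h' | h'
    · exact Or.inr ⟨h, h'⟩
    · exact Or.inl ⟨h, h'⟩

/-- Here k is the number of 2-cycles, and a, …, g count the blocks of types (7,0), (5,2), (3,4),
(1,6), (3,0), (1,2), (1,0), a type being the numbers of fixed and moved points in B ∩ xB. `e1`,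
`e2`, `e5` count fixed pairs, triples and quadruples; `e3` and `e4` count single 2-cycles and pairs
of them. -/
lemma involution_arithmetic {k a b c d e f g : ℕ} (hk1 : 1 ≤ k) (hk2 : k ≤ 11)
    (e0 : 253 = a + (b + (c + (d + (e + (f + g))))))
    (e1 : (23 - 2 * k).choose 2 * 21 = a * 21 + (b * 10 + (c * 3 + e * 3)))
    (e2 : (23 - 2 * k).choose 3 * 5 = a * 35 + (b * 10 + (c + e)))
    (e5 : (23 - 2 * k).choose 4 * 1 = a * 35 + b * 5)
    (e3 : 2 * k * 21 = b * 2 + (c * 4 + (d * 6 + f * 2)))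
    (e4 : 2 * k * (2 * k - 2) = c * 8 + d * 24) :
    k = 8 ∧ a + (b + (c + d)) = 29 ∧ g = 0 := by
  -- The combination `e1` − 3 `e2` + 4 `e5` eliminates every unknown but a; divisibility by 56 then
  -- leaves six values of k.
  have key : 56 * a + 3 * ((23 - 2 * k).choose 3 * 5) =
    (23 - 2 * k).choose 2 * 21 + 4 * (23 - 2 * k).choose 4 := by omega
  have hk : k = 1 ∨ k = 4 ∨ k = 6 ∨ k = 7 ∨ k = 8 ∨ k = 11 := by
    clear e0 e1 e2 e3 e4 e5
    interval_cases k <;> norm_num [Nat.choose] at key ⊢ <;> omega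
  rcases hk with rfl | rfl | rfl | rfl | rfl | rfl
  all_goals norm_num [Nat.choose] at e0 e1 e2 e3 e4 e5 key
  · obtain rfl : a = 150 := by clear e0 e1 e2 e3 e4 e5; omega
    obtain rfl : b = 147 := by clear e0 e1 e2 e3 e4; omega
    exfalso; clear e1 e2 e3 e4 e5; omega
  · obtain rfl : a = 15 := by clear e0 e1 e2 e3 e4 e5; omega
    obtain rfl : b = 168 := by clear e0 e1 e2 e3 e4; omega
    exfalso; clear e0 e1 e2 e4 e5; omega
  · obtain rfl : b = 66 := by clear e0 e1 e2 e3 e4; omega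
    obtain rfl : e = 165 - c := by clear e0 e2 e3 e4; omega
    exfalso; clear e1 e2 e5; omega
  · exfalso; clear e0 e1 e2 e3 e4; omega
  · obtain rfl : a = 1 := by clear e0 e1 e2 e3 e4 e5; omega
    obtain rfl : b = 0 := by clear e0 e1 e2 e3 e4; omega
    -- The total becomes 253 = 253 + 4d + g, so d = g = 0: the fixed blocks are one of type (7,0)
    -- and 28 of type (3,4).
    obtain rfl : c = 28 - 3 * d := by clear e0 e1 e2 e3; omega
    obtain rfl : f = 112 + 3 * d := by clear e0 e1 e2 e5; omega
    clear e2 e3 e5 key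
    omega
  · exfalso; clear e0 e2 e3 e5; omega

/-- An involutory automorphism of an `S(4, 7, 23)` has seven fixed points and 29 fixed blocks, and
every other block meets its image in three points. -/
theorem involution_structure (hS : IsSteinerSystem 4 7 23 𝓑) {x : Equiv.Perm P}
    (hx : x ∈ blockAut 𝓑) (hx2 : ∀ i, x (x i) = i) (hx1 : ∃ i, x i ≠ i) :
    (movedIn x Finset.univ).card = 16 ∧
    (𝓑.filter (fun B => B.map x.toEmbedding = B)).card = 29 ∧
    ∀ B ∈ 𝓑, B.map x.toEmbedding ≠ B → (B ∩ B.map x.toEmbedding).card = 3 := by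
  -- B ∩ xB has 7, 3 or 1 points, evenly many of them moved. The first four types have total 7,
  -- which means xB = B.
  set types : Finset (ℕ × ℕ) := {(7, 0), (5, 2), (3, 4), (1, 6), (3, 0), (1, 2), (1, 0)}
    with htypes
  set τ : Finset P → ℕ × ℕ := fun B => ((fixedIn x B).card, (movedIn x B).card) with hτ
  have hmem : ∀ B ∈ 𝓑, τ B ∈ types := by
    intro B hB
    have h1 := card_inter_map hx2 B
    have h2 := even_card_movedIn hx2 B
    have h3 : (fixedIn x B).card + (movedIn x B).card = 7 ∨
      (fixedIn x B).card + (movedIn x B).card = 3 ∨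
      (fixedIn x B).card + (movedIn x B).card = 1 := by
      rcases card_inter_map_of_mem hS hx hB with h | h | h <;> omega
    simp only [htypes, hτ, Finset.mem_insert, Finset.mem_singleton, Prod.mk.injEq]
    obtain ⟨p, hp⟩ := h2
    omega
  set N : ℕ × ℕ → ℕ := fun c => (𝓑.filter (fun B => τ B = c)).card with hN
  have key : ∀ f : ℕ × ℕ → ℕ, ∑ B ∈ 𝓑, f (τ B) = ∑ c ∈ types, N c * f c := by
    intro f
    rw [← Finset.sum_fiberwise_of_maps_to' hmem]
    simp [hN]
  have e0 := key (fun _ => 1)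
  have e1 : ∑ B ∈ 𝓑, (fixedIn x Finset.univ ∩ B).card.choose 2 = _ :=
    (Finset.sum_congr rfl fun B _ => by rw [← fixedIn_eq_inter]).trans
      (key (fun c => c.1.choose 2))
  have e2 : ∑ B ∈ 𝓑, (fixedIn x Finset.univ ∩ B).card.choose 3 = _ :=
    (Finset.sum_congr rfl fun B _ => by rw [← fixedIn_eq_inter]).trans
      (key (fun c => c.1.choose 3))
  have e5 : ∑ B ∈ 𝓑, (fixedIn x Finset.univ ∩ B).card.choose 4 = _ :=
    (Finset.sum_congr rfl fun B _ => by rw [← fixedIn_eq_inter]).trans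
      (key (fun c => c.1.choose 4))
  have e3 := key (fun c => c.2)
  have e4 := key (fun c => c.2 * (c.2 - 2))
  simp only [hτ] at e3 e4
  rw [sum_choose_card_inter (blocksThrough_of_card_eq_two hS)] at e1
  rw [sum_choose_card_inter (blocksThrough_of_card_eq_three hS)] at e2
  rw [sum_choose_card_inter (blocksThrough_of_card_eq_four hS)] at e5
  rw [sum_card_movedIn hS] at e3
  simp only [← card_movedPairs hx2] at e4
  rw [sum_card_movedPairs hS hx2, card_movedPairs hx2] at e4
  simp only [Finset.sum_const, card_blocks hS] at e0
  have hm := card_fixedIn_add_card_movedIn_univ x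
  rw [hS.card_points] at hm
  obtain ⟨k, hk⟩ := even_card_movedIn hx2 (Finset.univ : Finset P)
  have hpos : 0 < (movedIn x Finset.univ).card := by
    obtain ⟨i, hi⟩ := hx1
    exact Finset.card_pos.2 ⟨i, by simp [movedIn, hi]⟩
  have hF : (fixedIn x Finset.univ).card = 23 - 2 * k := by omega
  have hM : (movedIn x Finset.univ).card = 2 * k := by omega
  rw [hF] at e1 e2 e5
  rw [hM] at e3 e4
  have hsum : ∀ g : ℕ × ℕ → ℕ, ∑ c ∈ types, g c = g (7, 0) + (g (5, 2) + (g (3, 4) + (g (1, 6) +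
      (g (3, 0) + (g (1, 2) + g (1, 0)))))) := by
    intro g
    rw [htypes]
    repeat rw [Finset.sum_insert (by decide)]
    rw [Finset.sum_singleton]
  have hcount : ∀ t : Finset (ℕ × ℕ), (𝓑.filter (fun B => τ B ∈ t)).card = ∑ c ∈ t, N c := by
    intro t
    rw [Finset.card_eq_sum_card_fiberwise (f := τ) (t := t)
      (s := 𝓑.filter (fun B => τ B ∈ t)) (fun B hB => (Finset.mem_filter.1 hB).2)]
    apply Finset.sum_congr rfl
    intro c hc
    rw [Finset.filter_filter, hN]
    congr 1
    apply Finset.filter_congr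
    intro B _
    exact ⟨fun h => h.2, fun h => ⟨h ▸ hc, h⟩⟩
  have hfix := hcount {(7, 0), (5, 2), (3, 4), (1, 6)}
  have hone := hcount {(1, 0)}
  repeat rw [Finset.sum_insert (by decide)] at hfix
  rw [Finset.sum_singleton] at hfix hone
  have hfix' : 𝓑.filter (fun B => τ B ∈ ({(7, 0), (5, 2), (3, 4), (1, 6)} : Finset (ℕ × ℕ))) =
      𝓑.filter (fun B => B.map x.toEmbedding = B) := by
    apply Finset.filter_congr
    intro B hB
    have h1 := card_inter_map hx2 B
    have h2 := even_card_movedIn hx2 B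
    simp only [hτ, Finset.mem_insert, Finset.mem_singleton, Prod.mk.injEq]
    obtain ⟨p, hp⟩ := h2
    rcases card_inter_map_of_mem hS hx hB with ⟨h, h'⟩ | ⟨h, h'⟩ | ⟨h, h'⟩
    · simp only [h, iff_true]; omega
    · simp only [h, iff_false]; omega
    · simp only [h, iff_false]; omega
  rw [hfix'] at hfix
  simp only [hsum, mul_one] at e0 e1 e2 e3 e4 e5
  have hres : k = 8 ∧ N (7, 0) + (N (5, 2) + (N (3, 4) + N (1, 6))) = 29 ∧ N (1, 0) = 0 := by
    apply involution_arithmetic (by omega) (by omega)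
      (by simpa using e0) (by simpa [Nat.choose] using e1)
      (by simpa [Nat.choose] using e2)
      (by simpa [Nat.choose] using e5) (by simpa using e3) (by simpa using e4)
  obtain ⟨hk8, h29, h10⟩ := hres
  refine ⟨by omega, by rw [hfix, h29], ?_⟩
  intro B hB hne
  rcases card_inter_map_of_mem hS hx hB with ⟨h, h'⟩ | ⟨h, h'⟩ | ⟨h, h'⟩
  · exact absurd h hne
  · exact h'
  · exfalso
    rw [h10, Finset.card_eq_zero, Finset.filter_eq_empty_iff] at hone
    have h1 := card_inter_map hx2 B
    have h2 := even_card_movedIn hx2 B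
    obtain ⟨p, hp⟩ := h2
    apply hone hB
    simp only [hτ, Finset.mem_singleton, Prod.mk.injEq]
    omega

end Involution

/-! ### Integer vectors of norm four and the extended Hamming code. -/

section IntegerVectors

/-- The positions of the odd entries of an integer vector. -/
def oddSupport (a : Fin 8 → ℤ) : Finset (Fin 8) := Finset.univ.filter (fun i => Odd (a i))

lemma mem_oddSupport {a : Fin 8 → ℤ} {i : Fin 8} : i ∈ oddSupport a ↔ Odd (a i) := by
  simp [oddSupport]

lemma even_sum_iff_even_card_odd_int {ι : Type*} (s : Finset ι) (f : ι → ℤ) :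
    Even (∑ i ∈ s, f i) ↔ Even (s.filter (fun i => Odd (f i))).card := by
  classical
  induction s using Finset.induction_on with
  | empty => simp
  | insert i s hi ih =>
    rw [Finset.sum_insert hi, Int.even_add, ih, Finset.filter_insert]
    split_ifs with h
    · rw [Finset.card_insert_of_notMem (by simp [hi]), Nat.even_add_one]
      simp [← Int.not_odd_iff_even, h]
    · simp [Int.not_odd_iff_even.1 h]

/-- Reduction modulo two: this converts even inner products into a condition on binary words. -/
lemma even_sum_mul_iff (a b : Fin 8 → ℤ) :
    Even (∑ i, a i * b i) ↔ Even (oddSupport a ∩ oddSupport b).card := by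
  rw [even_sum_iff_even_card_odd_int]
  have : (Finset.univ.filter (fun i => Odd (a i * b i))) = oddSupport a ∩ oddSupport b := by
    ext i
    simp [mem_oddSupport, Int.odd_mul]
  rw [this]

lemma even_sum_iff_even_card_inter (D : Finset (Fin 8)) (b : Fin 8 → ℤ) :
    Even (∑ i ∈ D, b i) ↔ Even (D ∩ oddSupport b).card := by
  rw [even_sum_iff_even_card_odd_int]
  have : (D.filter (fun i => Odd (b i))) = D ∩ oddSupport b := by
    ext i
    simp [mem_oddSupport]
  rw [this]

/-- An entry ±2 uses up the whole norm; otherwise all entries are 0 or ±1 and exactly four are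
nonzero. -/
lemma sum_sq_eq_four_cases {a : Fin 8 → ℤ} (h : ∑ i, a i ^ 2 = 4) :
    (∃ i, ∃ b : Bool, a = Pi.single i (if b then 2 else -2)) ∨
    ((oddSupport a).card = 4 ∧ ∀ i, a i = 0 ∨ a i = 1 ∨ a i = -1) := by
  have hle : ∀ i, a i ^ 2 ≤ 4 := fun i =>
    h ▸ Finset.single_le_sum (f := fun i => a i ^ 2) (fun j _ => sq_nonneg (a j))
      (Finset.mem_univ i)
  by_cases h2 : ∃ i, a i = 2 ∨ a i = -2
  · left
    obtain ⟨i, hi⟩ := h2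
    refine ⟨i, decide (a i = 2), ?_⟩
    have hsq : a i ^ 2 = 4 := by rcases hi with hi | hi <;> rw [hi] <;> norm_num
    have h0 : ∑ j ∈ Finset.univ.erase i, a j ^ 2 = 0 := by
      have := Finset.add_sum_erase Finset.univ (fun j => a j ^ 2) (Finset.mem_univ i)
      omega
    rw [Finset.sum_eq_zero_iff_of_nonneg (fun j _ => sq_nonneg (a j))] at h0
    ext j
    by_cases hj : j = i
    · subst hj
      rcases hi with hi | hi <;> simp [hi]
    · rw [Pi.single_eq_of_ne hj]
      have := h0 j (Finset.mem_erase.2 ⟨hj, Finset.mem_univ j⟩)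
      simpa using this
  · right
    push Not at h2
    have hv : ∀ i, a i = 0 ∨ a i = 1 ∨ a i = -1 := by
      intro i
      have h1 := hle i
      have h3 := h2 i
      have h4 : a i ≤ 2 := by nlinarith
      have h5 : -2 ≤ a i := by nlinarith
      omega
    refine ⟨?_, hv⟩
    have : ∀ i, a i ^ 2 = if Odd (a i) then 1 else 0 := by
      intro i
      rcases hv i with h | h | h <;> rw [h] <;> decide
    rw [Finset.sum_congr rfl (fun i _ => this i), ← Finset.sum_filter] at h
    simp only [Finset.sum_const, nsmul_eq_mul, mul_one] at h
    exact_mod_cast h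

/-- The integer vectors of norm four with odd entries exactly on a given set `D`. -/
def normFourVectors (D : Finset (Fin 8)) : Finset (Fin 8 → ℤ) :=
  if D = ∅ then
    (Finset.univ : Finset (Fin 8 × Bool)).image fun p => Pi.single p.1 (if p.2 then 2 else -2)
  else D.powerset.image fun N i => if i ∈ D then (if i ∈ N then -1 else 1) else 0

lemma oddSupport_single (i : Fin 8) (b : Bool) :
    oddSupport (Pi.single i (if b then 2 else -2)) = ∅ := by
  ext j
  rw [mem_oddSupport, Pi.single_apply]
  split_ifs <;> simp [show ¬ Odd (2 : ℤ) by decide, show ¬ Odd (0 : ℤ) by decide]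

lemma card_oddSupport {a : Fin 8 → ℤ} (h : ∑ i, a i ^ 2 = 4) :
    (oddSupport a).card = 0 ∨ (oddSupport a).card = 4 := by
  rcases sum_sq_eq_four_cases h with ⟨i, b, rfl⟩ | ⟨h, _⟩
  · left; rw [oddSupport_single, Finset.card_empty]
  · exact Or.inr h

lemma mem_normFourVectors {a : Fin 8 → ℤ} (h : ∑ i, a i ^ 2 = 4) :
    a ∈ normFourVectors (oddSupport a) := by
  rcases sum_sq_eq_four_cases h with ⟨i, b, rfl⟩ | ⟨h, hv⟩
  · rw [oddSupport_single, normFourVectors, if_pos rfl]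
    exact Finset.mem_image.2 ⟨(i, b), Finset.mem_univ _, rfl⟩
  · rw [normFourVectors, if_neg (by rintro h0; rw [h0] at h; simp at h)]
    refine Finset.mem_image.2 ⟨(oddSupport a).filter (fun i => a i = -1), by simp, ?_⟩
    ext i
    simp only [Finset.mem_filter, mem_oddSupport]
    rcases hv i with h | h | h <;> rw [h] <;> decide

lemma card_normFourVectors_le {D : Finset (Fin 8)} (h : D.card = 0 ∨ D.card = 4) :
    (normFourVectors D).card ≤ 16 := by
  rw [normFourVectors]
  split_ifs with h0
  · exact Finset.card_image_le
  · refine Finset.card_image_le.trans ?_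
    rcases h with h | h
    · exact absurd (Finset.card_eq_zero.1 h) h0
    · rw [Finset.card_powerset, h]; norm_num

/-- The integer vectors of norm four that reduce modulo two to words of a fixed extended Hamming
code of length eight. -/
def hammingVectors : Set (Fin 8 → ℤ) :=
  {a | ∑ i, a i ^ 2 = 4 ∧ Even (∑ i ∈ {0, 1, 2, 3}, a i) ∧ Even (∑ i ∈ {0, 1, 4, 5}, a i) ∧
    Even (∑ i ∈ {0, 2, 4, 6}, a i) ∧ Even (∑ i ∈ {0, 1, 6, 7}, a i)}

/-- The words of weight zero and four of the extended Hamming code. -/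
def hammingWords : Finset (Finset (Fin 8)) :=
  Finset.univ.filter fun D => (D.card = 0 ∨ D.card = 4) ∧
    Even (({0, 1, 2, 3} : Finset (Fin 8)) ∩ D).card ∧
    Even (({0, 1, 4, 5} : Finset (Fin 8)) ∩ D).card ∧
    Even (({0, 2, 4, 6} : Finset (Fin 8)) ∩ D).card ∧
    Even (({0, 1, 6, 7} : Finset (Fin 8)) ∩ D).card

lemma card_hammingWords : hammingWords.card = 15 := by decide +kernel

lemma hammingVectors_subset :
    hammingVectors ⊆ ↑(hammingWords.biUnion normFourVectors) := by
  rintro a ⟨h, h1, h2, h3, h4⟩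
  rw [even_sum_iff_even_card_inter] at h1 h2 h3 h4
  refine Finset.mem_coe.2 (Finset.mem_biUnion.2 ⟨oddSupport a, ?_, mem_normFourVectors h⟩)
  exact Finset.mem_filter.2 ⟨Finset.mem_univ _, card_oddSupport h, h1, h2, h3, h4⟩

/-- 15 words with at most 16 vectors each. An upper bound suffices, because a set of 240 vectors
will be placed inside. -/
lemma card_biUnion_normFourVectors_le :
    (hammingWords.biUnion normFourVectors).card ≤ 240 := by
  refine (Finset.card_biUnion_le_card_mul _ _ 16 ?_).trans (by rw [card_hammingWords])
  intro D hD
  exact card_normFourVectors_le (Finset.mem_filter.1 hD).2.1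

end IntegerVectors

/-! ### Quadruples of eight points with even intersections. -/

section Quadruples

variable {𝒟 : Finset (Finset (Fin 8))}

lemma eq_of_three_le_card_inter (h4 : ∀ D ∈ 𝒟, D.card = 4)
    (he : ∀ D ∈ 𝒟, ∀ E ∈ 𝒟, Even (D ∩ E).card) {D E : Finset (Fin 8)} (hD : D ∈ 𝒟) (hE : E ∈ 𝒟)
    (h : 3 ≤ (D ∩ E).card) : D = E := by
  have h1 := Finset.card_le_card (Finset.inter_subset_left (s₁ := D) (s₂ := E))
  obtain ⟨k, hk⟩ := he D hD E hE
  have hD4 := h4 D hD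
  have hE4 := h4 E hE
  have e1 : D ∩ E = D := Finset.eq_of_subset_of_card_le Finset.inter_subset_left (by omega)
  have e2 : D ∩ E = E := Finset.eq_of_subset_of_card_le Finset.inter_subset_right (by omega)
  exact e1.symm.trans e2

/-- No triple lies in two quadruples, so 14 quadruples cover 14 · 4 = 56 = C(8,3) triples, which is
all of them. -/
lemma exists_superset_of_card_eq_three (h4 : ∀ D ∈ 𝒟, D.card = 4)
    (he : ∀ D ∈ 𝒟, ∀ E ∈ 𝒟, Even (D ∩ E).card) (h14 : 14 ≤ 𝒟.card) {T : Finset (Fin 8)}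
    (hT : T.card = 3) : ∃ D ∈ 𝒟, T ⊆ D := by
  have hcard : (𝒟.biUnion (fun D => D.powersetCard 3)).card = 𝒟.card * 4 := by
    rw [Finset.card_biUnion, Finset.sum_const_nat]
    · intro D hD
      rw [Finset.card_powersetCard, h4 D hD]; rfl
    · intro D hD E hE hne
      refine Finset.disjoint_left.2 ?_
      intro S hS hS'
      rw [Finset.mem_powersetCard] at hS hS'
      apply hne
      apply eq_of_three_le_card_inter h4 he hD hE
      rw [← hS.2]
      exact Finset.card_le_card (Finset.subset_inter hS.1 hS'.1)
  have heq : 𝒟.biUnion (fun D => D.powersetCard 3) =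
      (Finset.univ : Finset (Fin 8)).powersetCard 3 := by
    apply Finset.eq_of_subset_of_card_le
    · intro S hS
      obtain ⟨D, _, hS⟩ := Finset.mem_biUnion.1 hS
      exact Finset.mem_powersetCard.2 ⟨Finset.subset_univ _, (Finset.mem_powersetCard.1 hS).2⟩
    · rw [hcard, Finset.card_powersetCard, Finset.card_univ, Fintype.card_fin]
      have : Nat.choose 8 3 = 56 := by decide
      omega
  have : T ∈ 𝒟.biUnion (fun D => D.powersetCard 3) := by
    rw [heq]; exact Finset.mem_powersetCard.2 ⟨Finset.subset_univ _, hT⟩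
  obtain ⟨D, hD, hTD⟩ := Finset.mem_biUnion.1 this
  exact ⟨D, hD, (Finset.mem_powersetCard.1 hTD).1⟩

/-- Fourteen quadruples of eight points with even pairwise intersections contain, after
relabelling, four generators of a fixed extended Hamming code. -/
lemma exists_labelling (h4 : ∀ D ∈ 𝒟, D.card = 4)
    (he : ∀ D ∈ 𝒟, ∀ E ∈ 𝒟, Even (D ∩ E).card) (h14 : 14 ≤ 𝒟.card) :
    ∃ σ : Equiv.Perm (Fin 8), Finset.map σ.toEmbedding {0, 1, 2, 3} ∈ 𝒟 ∧
      Finset.map σ.toEmbedding {0, 1, 4, 5} ∈ 𝒟 ∧ Finset.map σ.toEmbedding {0, 2, 4, 6} ∈ 𝒟 ∧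
      Finset.map σ.toEmbedding {0, 1, 6, 7} ∈ 𝒟 := by
  have huniq : ∀ D ∈ 𝒟, ∀ E ∈ 𝒟, ∀ a b c : Fin 8, a ≠ b → a ≠ c → b ≠ c → a ∈ D → b ∈ D → c ∈ D →
      a ∈ E → b ∈ E → c ∈ E → D = E := by
    intro D hD E hE a b c hab hac hbc aD bD cD aE bE cE
    apply eq_of_three_le_card_inter h4 he hD hE
    have : ({a, b, c} : Finset (Fin 8)).card = 3 :=
      Finset.card_eq_three.2 ⟨a, b, c, hab, hac, hbc, rfl⟩
    rw [← this]
    apply Finset.card_le_card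
    intro i hi
    simp only [Finset.mem_insert, Finset.mem_singleton] at hi
    rcases hi with rfl | rfl | rfl <;> simp [*]
  have hext : ∀ a b c : Fin 8, a ≠ b → a ≠ c → b ≠ c →
      ∃ d, d ≠ a ∧ d ≠ b ∧ d ≠ c ∧ ({a, b, c, d} : Finset (Fin 8)) ∈ 𝒟 := by
    intro a b c hab hac hbc
    have hT : ({a, b, c} : Finset (Fin 8)).card = 3 :=
      Finset.card_eq_three.2 ⟨a, b, c, hab, hac, hbc, rfl⟩
    obtain ⟨D, hD, hTD⟩ := exists_superset_of_card_eq_three h4 he h14 hT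
    have h1 : (D \ {a, b, c}).card = 1 := by
      rw [Finset.card_sdiff_of_subset hTD, hT, h4 D hD]
    obtain ⟨d, hd⟩ := Finset.card_eq_one.1 h1
    have hdm : d ∈ D \ {a, b, c} := by rw [hd]; exact Finset.mem_singleton_self d
    simp only [Finset.mem_sdiff, Finset.mem_insert, Finset.mem_singleton, not_or] at hdm
    refine ⟨d, hdm.2.1, hdm.2.2.1, hdm.2.2.2, ?_⟩
    have : ({a, b, c, d} : Finset (Fin 8)) = D := by
      rw [← Finset.union_sdiff_of_subset hTD, hd]
      ext i; simp
    rw [this]; exact hD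
  -- Greedy labelling: 0, 1, 2 keep their names, p4 is any point off the first quadruple, and p3,
  -- p5, p6, p7 complete triples. Any coincidence among the labels would make two different
  -- quadruples share a triple.
  obtain ⟨p3, h30, h31, h32, hD1⟩ := hext 0 1 2 (by decide) (by decide) (by decide)
  obtain ⟨p4, hp4⟩ : ∃ p, p ∉ ({0, 1, 2, p3} : Finset (Fin 8)) := by
    by_contra! hall
    have := h4 _ hD1
    rw [Finset.eq_univ_of_forall hall] at this
    simp at this
  have hp4' := hp4
  simp only [Finset.mem_insert, Finset.mem_singleton, not_or] at hp4'
  obtain ⟨h40, h41, h42, h43⟩ := hp4'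
  rw [← ne_eq] at h40 h41 h42 h43
  obtain ⟨p5, h50, h51, h54, hD2⟩ := hext 0 1 p4 (by decide) (Ne.symm h40) (Ne.symm h41)
  have hD12 : ({0, 1, 2, p3} : Finset (Fin 8)) ≠ {0, 1, p4, p5} := by
    intro h; apply hp4; rw [h]; simp
  have h52 : p5 ≠ 2 := by
    rintro rfl
    exact hD12 (huniq _ hD1 _ hD2 0 1 2 (by decide) (by decide) (by decide) (by simp) (by simp)
      (by simp) (by simp) (by simp) (by simp))
  have h53 : p5 ≠ p3 := by
    rintro rfl
    exact hD12 (huniq _ hD1 _ hD2 0 1 p5 (by decide) h50.symm h51.symm (by simp) (by simp)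
      (by simp) (by simp) (by simp) (by simp))
  obtain ⟨p6, h60, h62, h64, hD3⟩ := hext 0 2 p4 (by decide) (Ne.symm h40) (Ne.symm h42)
  have hD13 : ({0, 1, 2, p3} : Finset (Fin 8)) ≠ {0, 2, p4, p6} := by
    intro h; apply hp4; rw [h]; simp
  have hD23 : ({0, 1, p4, p5} : Finset (Fin 8)) ≠ {0, 2, p4, p6} := by
    intro h
    have : (2 : Fin 8) ∈ ({0, 1, p4, p5} : Finset (Fin 8)) := by rw [h]; simp
    simp [h42.symm, h52.symm] at this
  have h61 : p6 ≠ 1 := by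
    rintro rfl
    exact hD13 (huniq _ hD1 _ hD3 0 1 2 (by decide) (by decide) (by decide) (by simp) (by simp)
      (by simp) (by simp) (by simp) (by simp))
  have h63 : p6 ≠ p3 := by
    rintro rfl
    exact hD13 (huniq _ hD1 _ hD3 0 2 p6 (by decide) h60.symm h62.symm (by simp) (by simp)
      (by simp) (by simp) (by simp) (by simp))
  have h65 : p6 ≠ p5 := by
    rintro rfl
    exact hD23 (huniq _ hD2 _ hD3 0 p4 p6 h40.symm h60.symm h64.symm (by simp) (by simp)
      (by simp) (by simp) (by simp) (by simp))
  obtain ⟨p7, h70, h71, h76, hD4⟩ := hext 0 1 p6 (by decide) (Ne.symm h60) (Ne.symm h61)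
  have hD14 : ({0, 1, 2, p3} : Finset (Fin 8)) ≠ {0, 1, p6, p7} := by
    intro h
    have : p6 ∈ ({0, 1, 2, p3} : Finset (Fin 8)) := by rw [h]; simp
    simp [h60, h61, h62, h63] at this
  have hD24 : ({0, 1, p4, p5} : Finset (Fin 8)) ≠ {0, 1, p6, p7} := by
    intro h
    have : p6 ∈ ({0, 1, p4, p5} : Finset (Fin 8)) := by rw [h]; simp
    simp [h60, h61, h64, h65] at this
  have h72 : p7 ≠ 2 := by
    rintro rfl
    exact hD14 (huniq _ hD1 _ hD4 0 1 2 (by decide) (by decide) (by decide) (by simp) (by simp)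
      (by simp) (by simp) (by simp) (by simp))
  have h73 : p7 ≠ p3 := by
    rintro rfl
    exact hD14 (huniq _ hD1 _ hD4 0 1 p7 (by decide) h70.symm h71.symm (by simp) (by simp)
      (by simp) (by simp) (by simp) (by simp))
  have h74 : p7 ≠ p4 := by
    rintro rfl
    exact hD24 (huniq _ hD2 _ hD4 0 1 p7 (by decide) h70.symm h71.symm (by simp) (by simp)
      (by simp) (by simp) (by simp) (by simp))
  have h75 : p7 ≠ p5 := by
    rintro rfl
    exact hD24 (huniq _ hD2 _ hD4 0 1 p7 (by decide) h70.symm h71.symm (by simp) (by simp)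
      (by simp) (by simp) (by simp) (by simp))
  have hinj : Function.Injective ![0, 1, 2, p3, p4, p5, p6, p7] := by
    rw [← List.nodup_ofFn]
    simp [Ne.symm h30, Ne.symm h31, Ne.symm h32, Ne.symm h40, Ne.symm h41, Ne.symm h42,
      Ne.symm h43, Ne.symm h50, Ne.symm h51, Ne.symm h52, Ne.symm h53, Ne.symm h54,
      Ne.symm h60, Ne.symm h61, Ne.symm h62, Ne.symm h63, Ne.symm h64, Ne.symm h65,
      Ne.symm h70, Ne.symm h71, Ne.symm h72, Ne.symm h73, Ne.symm h74, Ne.symm h75, Ne.symm h76]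
  refine ⟨Equiv.ofBijective _ (Finite.injective_iff_bijective.1 hinj), ?_, ?_, ?_, ?_⟩
  · simp only [Finset.map_insert, Finset.map_singleton]; exact hD1
  · simp only [Finset.map_insert, Finset.map_singleton]; exact hD2
  · simp only [Finset.map_insert, Finset.map_singleton]; exact hD3
  · simp only [Finset.map_insert, Finset.map_singleton]; exact hD4

end Quadruples

/-! ### The 240 integer vectors as the minimal vectors of E₈. -/

section MinimalVectors

/-- A set of 240 integer vectors of norm four in dimension eight with even inner products is,
up to a permutation of the coordinates, the set of all `hammingVectors`. -/
theorem exists_perm_image_eq_hammingVectors (A : Finset (Fin 8 → ℤ)) (hA : A.card = 240)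
    (hnorm : ∀ a ∈ A, ∑ i, a i ^ 2 = 4) (heven : ∀ a ∈ A, ∀ b ∈ A, Even (∑ i, a i * b i)) :
    ∃ σ : Equiv.Perm (Fin 8), (fun a : Fin 8 → ℤ => a ∘ σ) '' (A : Set (Fin 8 → ℤ)) =
      hammingVectors := by
  -- At most 16 vectors share an odd support, so 240 vectors have at least 15 supports, of which at
  -- least 14 are nonempty.
  have h15 : A.card ≤ 16 * (A.image oddSupport).card := by
    apply Finset.card_le_mul_card_image
    intro D hD
    obtain ⟨a, ha, rfl⟩ := Finset.mem_image.1 hD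
    refine (Finset.card_le_card ?_).trans (card_normFourVectors_le (card_oddSupport (hnorm a ha)))
    intro b hb
    obtain ⟨hb, hab⟩ := Finset.mem_filter.1 hb
    rw [← hab]
    exact mem_normFourVectors (hnorm b hb)
  have h14 : 14 ≤ ((A.image oddSupport).erase ∅).card := by
    have := Finset.pred_card_le_card_erase (s := A.image oddSupport) (a := ∅)
    omega
  obtain ⟨σ, h1, h2, h3, h4⟩ := exists_labelling (𝒟 := (A.image oddSupport).erase ∅)
    (by
      intro D hD
      obtain ⟨h0, hD⟩ := Finset.mem_erase.1 hD
      obtain ⟨a, ha, rfl⟩ := Finset.mem_image.1 hD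
      rcases card_oddSupport (hnorm a ha) with h | h
      · exact absurd (Finset.card_eq_zero.1 h) h0
      · exact h)
    (by
      intro D hD E hE
      obtain ⟨a, ha, rfl⟩ := Finset.mem_image.1 (Finset.mem_erase.1 hD).2
      obtain ⟨b, hb, rfl⟩ := Finset.mem_image.1 (Finset.mem_erase.1 hE).2
      exact (even_sum_mul_iff a b).1 (heven a ha b hb)) h14
  refine ⟨σ, ?_⟩
  have hgen : ∀ D : Finset (Fin 8), D.map σ.toEmbedding ∈ (A.image oddSupport).erase ∅ →
      ∀ b ∈ A, Even (∑ i ∈ D, (b ∘ σ) i) := by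
    intro D hD b hb
    obtain ⟨a, ha, hab⟩ := Finset.mem_image.1 (Finset.mem_erase.1 hD).2
    have : ∑ i ∈ D, (b ∘ σ) i = ∑ i ∈ D.map σ.toEmbedding, b i := by
      rw [Finset.sum_map]; rfl
    rw [this, even_sum_iff_even_card_inter, ← hab]
    exact (even_sum_mul_iff a b).1 (heven a ha b hb)
  have hsub : (fun a : Fin 8 → ℤ => a ∘ σ) '' (A : Set (Fin 8 → ℤ)) ⊆ hammingVectors := by
    rintro _ ⟨a, ha, rfl⟩
    refine ⟨?_, hgen _ h1 a ha, hgen _ h2 a ha, hgen _ h3 a ha, hgen _ h4 a ha⟩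
    rw [← hnorm a ha]
    exact Equiv.sum_comp σ (fun i => a i ^ 2)
  have hfin : hammingVectors.Finite := (Finset.finite_toSet _).subset hammingVectors_subset
  -- The inclusion is an equality because the right-hand side has at most 240 elements.
  apply Set.eq_of_subset_of_ncard_le hsub _ hfin
  have hinj : Function.Injective (fun a : Fin 8 → ℤ => a ∘ σ) := σ.surjective.injective_comp_right
  rw [Set.ncard_image_of_injective _ hinj, Set.ncard_coe_finset, hA]
  refine le_trans ?_ card_biUnion_normFourVectors_le
  rw [← Set.ncard_coe_finset]
  exact Set.ncard_le_ncard hammingVectors_subset (Finset.finite_toSet _)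

lemma norm_sq_R8 (v : R8) : ‖v‖ ^ 2 = ∑ i, v i ^ 2 := by
  rw [EuclideanSpace.norm_sq_eq]; simp

/-- For integer coordinates ∑ zᵢ² ≡ ∑ zᵢ is even, and it is positive; half-integer coordinates
contribute at least 1/4 each. -/
lemma two_le_norm_sq_of_mem_latticeE8 {w : R8} (hw : w ∈ latticeE8) (h0 : w ≠ 0) :
    2 ≤ ‖w‖ ^ 2 := by
  rw [norm_sq_R8]
  obtain ⟨⟨z, hz⟩ | ⟨z, hz⟩, m, hm⟩ := hw
  · simp only [hz] at hm ⊢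
    norm_cast at hm ⊢
    have hpos : 0 < ∑ i, z i ^ 2 := by
      by_contra! hle
      have h := le_antisymm hle (Finset.sum_nonneg fun i _ => sq_nonneg (z i))
      rw [Finset.sum_eq_zero_iff_of_nonneg (fun i _ => sq_nonneg (z i))] at h
      apply h0
      ext i
      have := h i (Finset.mem_univ i)
      rw [hz]; simpa using this
    have heven : Even (∑ i, z i ^ 2 - ∑ i, z i) := by
      rw [← Finset.sum_sub_distrib]
      apply Finset.even_sum
      intro i _
      rw [show z i ^ 2 - z i = z i * (z i - 1) by ring]
      exact Int.even_mul_pred_self (z i)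
    obtain ⟨k, hk⟩ := heven
    omega
  · have : ∀ i, (1 : ℝ) / 4 ≤ w i ^ 2 := by
      intro i
      have h : 0 ≤ z i * (z i + 1) := by
        rcases le_or_gt 0 (z i) with h | h
        · positivity
        · nlinarith
      have h' : (0 : ℝ) ≤ z i * (z i + 1) := by exact_mod_cast h
      rw [hz]; nlinarith
    calc (2 : ℝ) = ∑ _i : Fin 8, (1 : ℝ) / 4 := by simp; norm_num
      _ ≤ _ := Finset.sum_le_sum fun i _ => this i

lemma mem_minimalVectors_latticeE8 {v : R8} :
    v ∈ minimalVectors latticeE8 ↔ v ∈ latticeE8 ∧ ‖v‖ ^ 2 = 2 := by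
  constructor
  · rintro ⟨hv, h0, hmin⟩
    refine ⟨hv, le_antisymm ?_ (two_le_norm_sq_of_mem_latticeE8 hv h0)⟩
    have hw : (!₂[1, 1, 0, 0, 0, 0, 0, 0] : R8) ∈ latticeE8 := by
      refine ⟨Or.inl ⟨![1, 1, 0, 0, 0, 0, 0, 0], fun i => by fin_cases i <;> simp⟩, 1, ?_⟩
      simp [Fin.sum_univ_eight]; norm_num
    have hw2 : ‖(!₂[1, 1, 0, 0, 0, 0, 0, 0] : R8)‖ ^ 2 = 2 := by
      rw [norm_sq_R8]; simp [Fin.sum_univ_eight]; norm_num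
    have hw0 : (!₂[1, 1, 0, 0, 0, 0, 0, 0] : R8) ≠ 0 := by
      intro h; rw [h] at hw2; norm_num at hw2
    rw [← hw2]
    exact pow_le_pow_left₀ (norm_nonneg _) (hmin _ hw hw0) 2
  · rintro ⟨hv, h2⟩
    refine ⟨hv, ?_, ?_⟩
    · rintro rfl; norm_num at h2
    · intro w hw hw0
      have := two_le_norm_sq_of_mem_latticeE8 hw hw0
      rw [← h2] at this
      exact le_of_sq_le_sq this (norm_nonneg _)

/-- The change of coordinates of `ℝ⁸` from an orthogonal frame of vectors of norm two in the
`E₈` lattice to the standard basis, up to a factor. -/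
noncomputable def frameMap (c : R8) : R8 :=
  (√2)⁻¹ • !₂[c 0 + c 1, c 0 - c 1, c 2 + c 3, c 2 - c 3, c 4 + c 5, c 4 - c 5,
    c 6 + c 7, c 6 - c 7]

lemma inv_sqrt_two_mul_self : (√2)⁻¹ * (√2)⁻¹ = (1 / 2 : ℝ) := by
  rw [← mul_inv, Real.mul_self_sqrt (by norm_num)]; norm_num

lemma frameMap_involutive : Function.Involutive frameMap := by
  intro c
  ext i
  have h := inv_sqrt_two_mul_self
  fin_cases i <;> simp [frameMap]
  · linear_combination (2 * c 0) * h
  · linear_combination (2 * c 1) * h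
  · linear_combination (2 * c 2) * h
  · linear_combination (2 * c 3) * h
  · linear_combination (2 * c 4) * h
  · linear_combination (2 * c 5) * h
  · linear_combination (2 * c 6) * h
  · linear_combination (2 * c 7) * h

/-- The isometry of `ℝ⁸` underlying `frameMap`. -/
noncomputable def frameIsometry : R8 ≃ₗᵢ[ℝ] R8 where
  toLinearEquiv := LinearEquiv.ofInvolutive
    { toFun := frameMap
      map_add' := by
        intro a b
        ext i
        fin_cases i <;> simp [frameMap] <;> ring
      map_smul' := by
        intro r a
        ext i
        fin_cases i <;> simp [frameMap] <;> ring } frameMap_involutive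
  norm_map' := by
    intro c
    change ‖frameMap c‖ = ‖c‖
    rw [← sq_eq_sq₀ (norm_nonneg _) (norm_nonneg _), norm_sq_R8, norm_sq_R8]
    have h := inv_sqrt_two_mul_self
    simp [Fin.sum_univ_eight, frameMap, mul_pow]
    ring

/-- The vector with coordinates `a / √2`. -/
noncomputable def intVector (a : Fin 8 → ℤ) : R8 := WithLp.toLp 2 fun i => (√2)⁻¹ * (a i : ℝ)

lemma frameIsometry_intVector (a : Fin 8 → ℤ) :
    frameIsometry (intVector a) = !₂[((a 0 : ℝ) + a 1) / 2, ((a 0 : ℝ) - a 1) / 2,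
      ((a 2 : ℝ) + a 3) / 2, ((a 2 : ℝ) - a 3) / 2, ((a 4 : ℝ) + a 5) / 2,
      ((a 4 : ℝ) - a 5) / 2, ((a 6 : ℝ) + a 7) / 2, ((a 6 : ℝ) - a 7) / 2] := by
  change frameMap _ = _
  have h := inv_sqrt_two_mul_self
  ext i
  fin_cases i <;> simp [frameMap, intVector]
  · linear_combination ((a 0 : ℝ) + a 1) * h
  · linear_combination ((a 0 : ℝ) - a 1) * h
  · linear_combination ((a 2 : ℝ) + a 3) * h
  · linear_combination ((a 2 : ℝ) - a 3) * h
  · linear_combination ((a 4 : ℝ) + a 5) * h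
  · linear_combination ((a 4 : ℝ) - a 5) * h
  · linear_combination ((a 6 : ℝ) + a 7) * h
  · linear_combination ((a 6 : ℝ) - a 7) * h

lemma inner_intVector (a b : Fin 8 → ℤ) :
    ⟪intVector a, intVector b⟫ = (1 / 2) * ((∑ i, a i * b i : ℤ) : ℝ) := by
  rw [PiLp.inner_apply]
  push_cast
  rw [Finset.mul_sum]
  apply Finset.sum_congr rfl
  intro i _
  simp only [intVector, RCLike.inner_apply, conj_trivial]
  linear_combination ((a i : ℝ) * b i) * inv_sqrt_two_mul_self

lemma norm_sq_intVector (a : Fin 8 → ℤ) :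
    ‖intVector a‖ ^ 2 = (1 / 2) * ((∑ i, a i ^ 2 : ℤ) : ℝ) := by
  rw [← real_inner_self_eq_norm_sq, inner_intVector]
  simp only [sq]

/-- The checks on {0,1,2,3}, {0,1,4,5}, {0,1,6,7} give all sums a₂ⱼ + a₂ⱼ₊₁ the same parity, so the
image is integral or half-integral throughout. Its coordinate sum is a₀ + a₂ + a₄ + a₆, even by the
remaining check. -/
lemma frameIsometry_intVector_mem {a : Fin 8 → ℤ} (ha : a ∈ hammingVectors) :
    frameIsometry (intVector a) ∈ minimalVectors latticeE8 := by
  obtain ⟨h, h1, h2, h3, h4⟩ := ha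
  rw [mem_minimalVectors_latticeE8, LinearIsometryEquiv.norm_map, norm_sq_intVector, h]
  refine ⟨?_, by norm_num⟩
  rw [frameIsometry_intVector]
  simp only [Finset.sum_insert, Finset.sum_singleton, Finset.mem_insert, Finset.mem_singleton,
    Fin.reduceEq, or_self, not_false_eq_true] at h1 h2 h3 h4
  obtain ⟨m1, h1⟩ := h1
  obtain ⟨m2, h2⟩ := h2
  obtain ⟨m3, h3⟩ := h3
  obtain ⟨m4, h4⟩ := h4
  refine ⟨?_, m3, ?_⟩
  · rcases Int.even_or_odd (a 0 + a 1) with he | ho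
    · left
      refine ⟨![(a 0 + a 1) / 2, (a 0 - a 1) / 2, (a 2 + a 3) / 2, (a 2 - a 3) / 2,
        (a 4 + a 5) / 2, (a 4 - a 5) / 2, (a 6 + a 7) / 2, (a 6 - a 7) / 2], ?_⟩
      obtain ⟨m, hm⟩ := he
      intro i
      fin_cases i <;> simp <;> rw [Int.cast_div (by omega) (by norm_num)] <;> push_cast <;> ring
    · right
      refine ⟨![(a 0 + a 1 - 1) / 2, (a 0 - a 1 - 1) / 2, (a 2 + a 3 - 1) / 2,
        (a 2 - a 3 - 1) / 2, (a 4 + a 5 - 1) / 2, (a 4 - a 5 - 1) / 2, (a 6 + a 7 - 1) / 2,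
        (a 6 - a 7 - 1) / 2], ?_⟩
      obtain ⟨m, hm⟩ := ho
      intro i
      fin_cases i <;> simp <;> rw [Int.cast_div (by omega) (by norm_num)] <;> push_cast <;> ring
  · have : ((a 0 : ℝ) + (a 2 + (a 4 + a 6))) = m3 + m3 := by exact_mod_cast h3
    simp [Fin.sum_univ_eight]
    linear_combination this

lemma exists_hammingVector_of_mem {v : R8} (hv : v ∈ minimalVectors latticeE8) :
    ∃ a ∈ hammingVectors, frameIsometry (intVector a) = v := by
  rw [mem_minimalVectors_latticeE8] at hv
  obtain ⟨⟨hz, m, hm⟩, h2⟩ := hv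
  suffices h : ∃ a : Fin 8 → ℤ, frameIsometry (intVector a) = v ∧
      Even (∑ i ∈ {0, 1, 2, 3}, a i) ∧ Even (∑ i ∈ {0, 1, 4, 5}, a i) ∧
      Even (∑ i ∈ {0, 2, 4, 6}, a i) ∧ Even (∑ i ∈ {0, 1, 6, 7}, a i) by
    obtain ⟨a, ha, h⟩ := h
    refine ⟨a, ⟨?_, h⟩, ha⟩
    rw [← ha, LinearIsometryEquiv.norm_map, norm_sq_intVector] at h2
    have : ((∑ i, a i ^ 2 : ℤ) : ℝ) = 4 := by linarith
    exact_mod_cast this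
  simp only [Finset.sum_insert, Finset.sum_singleton, Finset.mem_insert, Finset.mem_singleton,
    Fin.reduceEq, or_self, not_false_eq_true]
  rcases hz with ⟨z, hz⟩ | ⟨z, hz⟩
  · refine ⟨![z 0 + z 1, z 0 - z 1, z 2 + z 3, z 2 - z 3, z 4 + z 5, z 4 - z 5, z 6 + z 7,
      z 6 - z 7], ?_, ?_⟩
    · rw [frameIsometry_intVector]
      ext i
      fin_cases i <;> simp [hz]
    · simp only [hz, Fin.sum_univ_eight] at hm
      norm_cast at hm
      simp
      refine ⟨⟨z 0 + z 2, by ring⟩, ⟨z 0 + z 4, by ring⟩, ⟨m, by linarith⟩, ⟨z 0 + z 6, by ring⟩⟩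
  -- The halves add to 1 in v₂ⱼ + v₂ⱼ₊₁ and cancel in v₂ⱼ − v₂ⱼ₊₁.
  · refine ⟨![z 0 + z 1 + 1, z 0 - z 1, z 2 + z 3 + 1, z 2 - z 3, z 4 + z 5 + 1, z 4 - z 5,
      z 6 + z 7 + 1, z 6 - z 7], ?_, ?_⟩
    · rw [frameIsometry_intVector]
      ext i
      fin_cases i <;> simp [hz] <;> ring
    · simp only [hz, Fin.sum_univ_eight] at hm
      have hm' : z 0 + z 1 + z 2 + z 3 + z 4 + z 5 + z 6 + z 7 + 4 = 2 * m := by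
        have : ((z 0 + z 1 + z 2 + z 3 + z 4 + z 5 + z 6 + z 7 + 4 : ℤ) : ℝ) = (2 * m : ℤ) := by
          push_cast; linear_combination hm
        exact_mod_cast this
      simp
      refine ⟨⟨z 0 + z 2 + 1, by ring⟩, ⟨z 0 + z 4 + 1, by ring⟩, ⟨m, by linarith⟩,
        ⟨z 0 + z 6 + 1, by ring⟩⟩

/-- The `hammingVectors` are the coordinates of the minimal vectors of the `E₈` lattice with
respect to an orthogonal frame. -/
theorem image_hammingVectors :
    (fun a => frameIsometry (intVector a)) '' hammingVectors = minimalVectors latticeE8 := by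
  apply Set.Subset.antisymm
  · rintro _ ⟨a, ha, rfl⟩
    exact frameIsometry_intVector_mem ha
  · intro v hv
    exact exists_hammingVector_of_mem hv

end MinimalVectors

/-! ### Inner products computed from the Gram matrix of the αᵢ. -/

section Gram

variable {P : Type*} [Fintype P] [DecidableEq P] {α : P → R23}

set_option linter.unusedSectionVars false

lemma inner_eq_ite (hunit : ∀ i, ‖α i‖ = 1) (hangle : ∀ i j, i ≠ j → ⟪α i, α j⟫ = 1 / 5)
    (i j : P) : ⟪α i, α j⟫ = 1 / 5 + if i = j then 4 / 5 else 0 := by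
  split_ifs with h
  · subst h; rw [real_inner_self_eq_norm_sq, hunit]; norm_num
  · rw [hangle i j h, add_zero]

lemma inner_sum_smul_sum_smul (hunit : ∀ i, ‖α i‖ = 1)
    (hangle : ∀ i j, i ≠ j → ⟪α i, α j⟫ = 1 / 5) (c d : P → ℝ) :
    ⟪∑ i, c i • α i, ∑ i, d i • α i⟫ =
      4 / 5 * ∑ i, c i * d i + 1 / 5 * ((∑ i, c i) * ∑ i, d i) := by
  simp only [sum_inner, inner_sum, real_inner_smul_left, real_inner_smul_right,
    inner_eq_ite hunit hangle, mul_add, Finset.sum_add_distrib, mul_ite, mul_zero,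
    Finset.sum_ite_eq', Finset.mem_univ, if_true]
  rw [mul_comm (∑ i, c i), Finset.sum_mul_sum, Finset.mul_sum, Finset.mul_sum, add_comm]
  congr 1
  · apply Finset.sum_congr rfl; intro i _; ring
  · apply Finset.sum_congr rfl; intro i _
    rw [Finset.mul_sum]
    apply Finset.sum_congr rfl; intro j _; ring

lemma linearIndependent_of_inner (hunit : ∀ i, ‖α i‖ = 1)
    (hangle : ∀ i j, i ≠ j → ⟪α i, α j⟫ = 1 / 5) : LinearIndependent ℝ α := by
  rw [Fintype.linearIndependent_iff]
  intro c hc i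
  have h := inner_sum_smul_sum_smul hunit hangle c c
  rw [hc, inner_zero_left] at h
  have h1 : 0 ≤ (∑ i, c i) * ∑ i, c i := mul_self_nonneg _
  have h2 : 0 ≤ ∑ i, c i * c i := Finset.sum_nonneg fun i _ => mul_self_nonneg _
  have h3 : ∑ i, c i * c i = 0 := by linarith
  rw [Finset.sum_eq_zero_iff_of_nonneg (fun i _ => mul_self_nonneg _)] at h3
  simpa using h3 i (Finset.mem_univ i)

/-- The basis of `ℝ²³` formed by 23 unit vectors with pairwise inner products `1/5`. -/
noncomputable def equiangularBasis (hcard : Fintype.card P = 23) (hunit : ∀ i, ‖α i‖ = 1)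
    (hangle : ∀ i j, i ≠ j → ⟪α i, α j⟫ = 1 / 5) : Module.Basis P ℝ R23 :=
  haveI : Nonempty P := Fintype.card_pos_iff.1 (by omega)
  basisOfLinearIndependentOfCardEqFinrank (linearIndependent_of_inner hunit hangle)
    (by rw [hcard, finrank_euclideanSpace_fin])

lemma equiangularBasis_apply (hcard : Fintype.card P = 23) (hunit : ∀ i, ‖α i‖ = 1)
    (hangle : ∀ i j, i ≠ j → ⟪α i, α j⟫ = 1 / 5) (i : P) :
    equiangularBasis hcard hunit hangle i = α i := by
  simp [equiangularBasis]

lemma exists_eq_sum_smul (hcard : Fintype.card P = 23) (hunit : ∀ i, ‖α i‖ = 1)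
    (hangle : ∀ i j, i ≠ j → ⟪α i, α j⟫ = 1 / 5) (u : R23) :
    ∃ c : P → ℝ, u = ∑ i, c i • α i := by
  refine ⟨(equiangularBasis hcard hunit hangle).repr u, ?_⟩
  conv_lhs => rw [← (equiangularBasis hcard hunit hangle).sum_repr u]
  simp only [equiangularBasis_apply]

/-- The coefficients of a block vector. -/
noncomputable def blockCoeff (B : Finset P) (i : P) : ℝ := if i ∈ B then 1 / 3 else -(1 / 6)

lemma blockVector_eq_sum_smul (B : Finset P) :
    blockVector α B = ∑ i, blockCoeff B i • α i := by
  rw [blockVector, ← Finset.sum_add_sum_compl B, sub_eq_add_neg, ← neg_smul, Finset.smul_sum,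
    Finset.smul_sum]
  congr 1
  · apply Finset.sum_congr rfl
    intro i hi
    rw [blockCoeff, if_pos hi]
  · apply Finset.sum_congr rfl
    intro i hi
    rw [blockCoeff, if_neg (Finset.mem_compl.1 hi)]

lemma blockCoeff_eq (B : Finset P) (i : P) :
    blockCoeff B i = 1 / 2 * (if i ∈ B then 1 else 0) - 1 / 6 := by
  rw [blockCoeff]; split_ifs <;> norm_num

lemma sum_blockCoeff (hcard : Fintype.card P = 23) {B : Finset P} (hB : B.card = 7) :
    ∑ i, blockCoeff B i = -(1 / 3) := by
  simp only [blockCoeff_eq, Finset.sum_sub_distrib, ← Finset.mul_sum, Finset.sum_ite_mem,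
    Finset.univ_inter, Finset.sum_const, Finset.card_univ, hcard, hB, nsmul_eq_mul]
  norm_num

lemma sum_blockCoeff_mul_blockCoeff (hcard : Fintype.card P = 23) {B C : Finset P}
    (hB : B.card = 7) (hC : C.card = 7) :
    ∑ i, blockCoeff B i * blockCoeff C i = ((B ∩ C).card : ℝ) / 4 - 19 / 36 := by
  have h : ∀ i, blockCoeff B i * blockCoeff C i = 1 / 4 * (if i ∈ B ∩ C then 1 else 0) -
      1 / 6 * blockCoeff B i - 1 / 6 * blockCoeff C i - 1 / 36 := by
    intro i
    simp only [blockCoeff_eq, Finset.mem_inter]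
    by_cases h1 : i ∈ B <;> by_cases h2 : i ∈ C <;> simp [h1, h2] <;> norm_num
  simp only [h, Finset.sum_sub_distrib, ← Finset.mul_sum, sum_blockCoeff hcard hB,
    sum_blockCoeff hcard hC, Finset.sum_ite_mem, Finset.univ_inter, Finset.sum_const,
    Finset.card_univ, hcard, nsmul_eq_mul]
  ring

/-- Intersection sizes 1, 3 and 7 give −1/5, 1/5 and 1. -/
lemma inner_blockVector_blockVector (hcard : Fintype.card P = 23) (hunit : ∀ i, ‖α i‖ = 1)
    (hangle : ∀ i j, i ≠ j → ⟪α i, α j⟫ = 1 / 5) {B C : Finset P}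
    (hB : B.card = 7) (hC : C.card = 7) :
    ⟪blockVector α B, blockVector α C⟫ = (((B ∩ C).card : ℝ) - 2) / 5 := by
  rw [blockVector_eq_sum_smul, blockVector_eq_sum_smul, inner_sum_smul_sum_smul hunit hangle,
    sum_blockCoeff_mul_blockCoeff hcard hB hC, sum_blockCoeff hcard hB, sum_blockCoeff hcard hC]
  ring

lemma inner_blockVector_right (hcard : Fintype.card P = 23) (hunit : ∀ i, ‖α i‖ = 1)
    (hangle : ∀ i j, i ≠ j → ⟪α i, α j⟫ = 1 / 5) (i : P) {B : Finset P} (hB : B.card = 7) :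
    ⟪α i, blockVector α B⟫ = if i ∈ B then 1 / 5 else -(1 / 5) := by
  have : α i = ∑ j, (Pi.single i (1 : ℝ) : P → ℝ) j • α j := by
    simp [Pi.single_apply, ite_smul]
  rw [this, blockVector_eq_sum_smul, inner_sum_smul_sum_smul hunit hangle,
    sum_blockCoeff hcard hB]
  simp only [Pi.single_apply, ite_mul, one_mul, zero_mul, Finset.sum_ite_eq', Finset.mem_univ,
    if_true, blockCoeff]
  split_ifs <;> norm_num

end Gram

/-! ### The 276 line vectors and the action of the involution on them. -/

section Lines

variable {P : Type*} [Fintype P] [DecidableEq P] {𝓑 : Finset (Finset P)} {α : P → R23}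

/-- The line vectors, indexed by the points and the blocks. -/
noncomputable def lineVector (𝓑 : Finset (Finset P)) (α : P → R23) : P ⊕ 𝓑 → R23 :=
  Sum.elim α (fun B => blockVector α B.1)

lemma range_lineVector : Set.range (lineVector 𝓑 α) = lineVectors 𝓑 α := by
  ext u
  simp only [lineVector, Set.Sum.elim_range, lineVectors, Set.mem_union, Set.mem_range,
    Set.mem_ofPred_eq, Subtype.exists]
  simp only [eq_comm, exists_prop]

lemma norm_lineVector (hS : IsSteinerSystem 4 7 23 𝓑) (hunit : ∀ i, ‖α i‖ = 1)
    (hangle : ∀ i j, i ≠ j → ⟪α i, α j⟫ = 1 / 5) (s : P ⊕ 𝓑) : ‖lineVector 𝓑 α s‖ = 1 := by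
  rcases s with i | ⟨B, hB⟩
  · exact hunit i
  · change ‖blockVector α B‖ = 1
    have h := inner_blockVector_blockVector hS.card_points hunit hangle (hS.card_block B hB)
      (hS.card_block B hB)
    rw [Finset.inter_self, hS.card_block B hB, real_inner_self_eq_norm_sq] at h
    rw [← sq_eq_sq₀ (norm_nonneg _) zero_le_one, h]
    norm_num

lemma inner_lineVector (hS : IsSteinerSystem 4 7 23 𝓑) (hunit : ∀ i, ‖α i‖ = 1)
    (hangle : ∀ i j, i ≠ j → ⟪α i, α j⟫ = 1 / 5) {s t : P ⊕ 𝓑} (hne : s ≠ t) :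
    ⟪lineVector 𝓑 α s, lineVector 𝓑 α t⟫ = 1 / 5 ∨
      ⟪lineVector 𝓑 α s, lineVector 𝓑 α t⟫ = -(1 / 5) := by
  rcases s with i | ⟨B, hB⟩ <;> rcases t with j | ⟨C, hC⟩
  · exact Or.inl (hangle i j fun h => hne (by rw [h]))
  · change ⟪α i, blockVector α C⟫ = _ ∨ ⟪α i, blockVector α C⟫ = _
    rw [inner_blockVector_right hS.card_points hunit hangle i (hS.card_block C hC)]
    split_ifs <;> simp
  · change ⟪blockVector α B, α j⟫ = _ ∨ ⟪blockVector α B, α j⟫ = _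
    rw [real_inner_comm,
      inner_blockVector_right hS.card_points hunit hangle j (hS.card_block B hB)]
    split_ifs <;> simp
  · change ⟪blockVector α B, blockVector α C⟫ = _ ∨ ⟪blockVector α B, blockVector α C⟫ = _
    rw [inner_blockVector_blockVector hS.card_points hunit hangle (hS.card_block B hB)
      (hS.card_block C hC)]
    rcases card_inter_eq_one_or_three hS hB hC (fun h => hne (by subst h; rfl)) with h | h <;>
      rw [h] <;> norm_num

lemma lineVector_injective (hS : IsSteinerSystem 4 7 23 𝓑) (hunit : ∀ i, ‖α i‖ = 1)
    (hangle : ∀ i j, i ≠ j → ⟪α i, α j⟫ = 1 / 5) : Function.Injective (lineVector 𝓑 α) := by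
  intro s t hst
  by_contra hne
  have h := inner_lineVector hS hunit hangle hne
  rw [hst, real_inner_self_eq_norm_sq, norm_lineVector hS hunit hangle] at h
  norm_num at h

lemma card_lineIndex (hS : IsSteinerSystem 4 7 23 𝓑) : Fintype.card (P ⊕ 𝓑) = 276 := by
  rw [Fintype.card_sum, Fintype.card_coe, hS.card_points, card_blocks hS]

/-- The action of an automorphism on the indices of the line vectors. -/
def lineAction {x : Equiv.Perm P} (hx : x ∈ blockAut 𝓑) : P ⊕ 𝓑 → P ⊕ 𝓑 :=
  Sum.map x (fun B => ⟨B.1.map x.toEmbedding, map_mem_of_mem_blockAut hx B.2⟩)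

lemma lineAction_lineAction {x : Equiv.Perm P} (hx : x ∈ blockAut 𝓑) (hx2 : ∀ i, x (x i) = i)
    (s : P ⊕ 𝓑) : lineAction hx (lineAction hx s) = s := by
  rcases s with i | ⟨B, hB⟩
  · simp [lineAction, hx2]
  · simp only [lineAction, Sum.map_inr, Sum.inr.injEq, Subtype.mk.injEq]
    ext i
    have : ∀ j, x.symm j = x j := fun j => by rw [Equiv.symm_apply_eq, hx2]
    rw [Finset.mem_map_equiv, Finset.mem_map_equiv, this, this, hx2]

lemma map_lineVector {x : Equiv.Perm P} (hx : x ∈ blockAut 𝓑) {T : R23 →ₗ[ℝ] R23}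
    (hT : ∀ i, T (α i) = α (x i)) (s : P ⊕ 𝓑) :
    T (lineVector 𝓑 α s) = lineVector 𝓑 α (lineAction hx s) := by
  rcases s with i | ⟨B, hB⟩
  · exact hT i
  · change T (blockVector α B) = blockVector α (B.map x.toEmbedding)
    have hc : (B.map x.toEmbedding)ᶜ = Bᶜ.map x.toEmbedding := by
      ext i; simp [Finset.mem_map_equiv]
    simp only [blockVector, map_sub, map_smul, map_sum, hT, hc, Finset.sum_map,
      Equiv.coe_toEmbedding]

/-- The sign is the point: a moved block meets its image in three points, never one, so all moved
vectors project to the same length. -/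
lemma inner_lineVector_lineAction (hS : IsSteinerSystem 4 7 23 𝓑) (hunit : ∀ i, ‖α i‖ = 1)
    (hangle : ∀ i j, i ≠ j → ⟪α i, α j⟫ = 1 / 5) {x : Equiv.Perm P} (hx : x ∈ blockAut 𝓑)
    (hx2 : ∀ i, x (x i) = i) (hx1 : ∃ i, x i ≠ i) {s : P ⊕ 𝓑} (hs : lineAction hx s ≠ s) :
    ⟪lineVector 𝓑 α s, lineVector 𝓑 α (lineAction hx s)⟫ = 1 / 5 := by
  rcases s with i | ⟨B, hB⟩
  · exact hangle i (x i) fun h => hs (by simp [lineAction, ← h])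
  · change ⟪blockVector α B, blockVector α (B.map x.toEmbedding)⟫ = 1 / 5
    rw [inner_blockVector_blockVector hS.card_points hunit hangle (hS.card_block B hB)
      (hS.card_block _ (map_mem_of_mem_blockAut hx hB)),
      (involution_structure hS hx hx2 hx1).2.2 B hB (fun h => hs (by simp [lineAction, h]))]
    norm_num

lemma card_lineAction_fixed (hS : IsSteinerSystem 4 7 23 𝓑) {x : Equiv.Perm P}
    (hx : x ∈ blockAut 𝓑) (hx2 : ∀ i, x (x i) = i) (hx1 : ∃ i, x i ≠ i) :
    (Finset.univ.filter (fun s : P ⊕ 𝓑 => lineAction hx s = s)).card = 36 := by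
  obtain ⟨h16, h29, _⟩ := involution_structure hS hx hx2 hx1
  have h := card_fixedIn_add_card_movedIn_univ x
  rw [hS.card_points, h16] at h
  have h7 : (fixedIn x Finset.univ).card = 7 := by omega
  have e : Finset.univ.filter (fun s : P ⊕ 𝓑 => lineAction hx s = s) =
      (fixedIn x Finset.univ).disjSum
        (Finset.univ.filter (fun B : 𝓑 => B.1.map x.toEmbedding = B.1)) := by
    ext s
    rcases s with i | B
    · rw [Finset.mem_filter, Finset.inl_mem_disjSum]
      simp [lineAction, fixedIn]
    · rw [Finset.mem_filter, Finset.inr_mem_disjSum, Finset.mem_filter]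
      simp [lineAction, Subtype.ext_iff]
  rw [e, Finset.card_disjSum, h7]
  have : (Finset.univ.filter (fun B : 𝓑 => B.1.map x.toEmbedding = B.1)).card = 29 := by
    rw [← h29, Finset.univ_eq_attach, ← Finset.card_map (Function.Embedding.subtype _)]
    congr 1
    ext B
    simp [and_comm]
  rw [this]

lemma card_lineAction_moved (hS : IsSteinerSystem 4 7 23 𝓑) {x : Equiv.Perm P}
    (hx : x ∈ blockAut 𝓑) (hx2 : ∀ i, x (x i) = i) (hx1 : ∃ i, x i ≠ i) :
    (Finset.univ.filter (fun s : P ⊕ 𝓑 => lineAction hx s ≠ s)).card = 240 := by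
  have h1 := card_lineAction_fixed hS hx hx2 hx1
  have h2 := Finset.card_filter_add_card_filter_not (s := Finset.univ)
    (fun s : P ⊕ 𝓑 => lineAction hx s = s)
  rw [h1, Finset.card_univ, card_lineIndex hS] at h2
  simp only [ne_eq]
  omega

end Lines

/-! ### Projection onto the (−1)-eigenspace and an orthogonal frame there. -/

section Projection

variable {P : Type*} [Fintype P] [DecidableEq P] {α : P → R23} {x : Equiv.Perm P}
  {T : R23 →ₗ[ℝ] R23}

lemma inner_map_map_of_permutes (hcard : Fintype.card P = 23) (hunit : ∀ i, ‖α i‖ = 1)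
    (hangle : ∀ i j, i ≠ j → ⟪α i, α j⟫ = 1 / 5) (hT : ∀ i, T (α i) = α (x i)) (u v : R23) :
    ⟪T u, T v⟫ = ⟪u, v⟫ := by
  obtain ⟨c, rfl⟩ := exists_eq_sum_smul hcard hunit hangle u
  obtain ⟨d, rfl⟩ := exists_eq_sum_smul hcard hunit hangle v
  simp only [map_sum, map_smul, hT, sum_inner, inner_sum, real_inner_smul_left,
    real_inner_smul_right, inner_eq_ite hunit hangle, x.injective.eq_iff]

lemma map_map_of_permutes (hcard : Fintype.card P = 23) (hunit : ∀ i, ‖α i‖ = 1)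
    (hangle : ∀ i j, i ≠ j → ⟪α i, α j⟫ = 1 / 5) (hT : ∀ i, T (α i) = α (x i))
    (hx2 : ∀ i, x (x i) = i) (u : R23) : T (T u) = u := by
  obtain ⟨c, rfl⟩ := exists_eq_sum_smul hcard hunit hangle u
  simp only [map_sum, map_smul, hT, hx2]

/-- The orthogonal projection onto the `(-1)`-eigenspace of a linear map. -/
noncomputable abbrev antiProj (T : R23 →ₗ[ℝ] R23) (u : R23) : Module.End.eigenspace T (-1) :=
  (Module.End.eigenspace T (-1)).orthogonalProjectionOnto u

/-- For w with Tw = −w, invariance gives ⟪Tu, w⟫ = −⟪u, w⟫, so the remainder (u + Tu)/2 is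
orthogonal to w. -/
lemma coe_antiProj (hT1 : ∀ u v, ⟪T u, T v⟫ = ⟪u, v⟫) (hT2 : ∀ u, T (T u) = u) (u : R23) :
    (antiProj T u : R23) = (1 / 2 : ℝ) • (u - T u) := by
  rw [antiProj, Submodule.coe_orthogonalProjectionOnto_apply]
  apply Submodule.eq_starProjection_of_mem_of_inner_eq_zero
  · rw [Module.End.mem_eigenspace_iff, map_smul, map_sub, hT2]
    module
  · intro w hw
    rw [Module.End.mem_eigenspace_iff] at hw
    have h := hT1 u w
    rw [hw, inner_smul_right] at h
    simp only [inner_sub_left, inner_smul_left]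
    simp
    linarith

lemma inner_antiProj (hT1 : ∀ u v, ⟪T u, T v⟫ = ⟪u, v⟫) (hT2 : ∀ u, T (T u) = u) (u v : R23) :
    ⟪antiProj T u, antiProj T v⟫ = 1 / 2 * (⟪u, v⟫ - ⟪u, T v⟫) := by
  have h1 := hT1 u v
  have h2 := hT1 u (T v)
  rw [hT2] at h2
  rw [Submodule.coe_inner, coe_antiProj hT1 hT2, coe_antiProj hT1 hT2]
  simp only [inner_sub_left, inner_sub_right, real_inner_smul_left, real_inner_smul_right]
  rw [h1, h2]
  ring

lemma antiProj_map (hT1 : ∀ u v, ⟪T u, T v⟫ = ⟪u, v⟫) (hT2 : ∀ u, T (T u) = u) (u : R23) :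
    antiProj T (T u) = -antiProj T u := by
  apply Subtype.ext
  rw [Submodule.coe_neg, coe_antiProj hT1 hT2, coe_antiProj hT1 hT2, hT2]
  module

lemma inner_smul_smul_eigenspace (r q : ℝ) (v w : Module.End.eigenspace T (-1)) :
    ⟪r • v, q • w⟫ = r * q * ⟪v, w⟫ := by
  rw [Submodule.coe_inner, Submodule.coe_inner, Submodule.coe_smul, Submodule.coe_smul,
    real_inner_smul_left, real_inner_smul_right, mul_assoc]

/-- A set of representatives of the orbits of length two of an involution moving 16 points. -/
lemma exists_transversal (hx2 : ∀ i, x (x i) = i) (h16 : (movedIn x Finset.univ).card = 16) :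
    ∃ τ : Fin 8 → P, Function.Injective τ ∧ (∀ s t, τ s ≠ x (τ t)) ∧
      ∀ i, x i ≠ i → ∃ t, i = τ t ∨ i = x (τ t) := by
  set e := Fintype.equivFin P
  -- An arbitrary numbering of the points selects the smaller one in each 2-cycle.
  set S : Finset P := Finset.univ.filter (fun i => e i < e (x i)) with hSdef
  have hmem : ∀ i, i ∈ S ↔ e i < e (x i) := by simp [hSdef]
  have hdisj : Disjoint S (S.map x.toEmbedding) := by
    rw [Finset.disjoint_left]
    intro i hi hi'
    obtain ⟨j, hj, rfl⟩ := Finset.mem_map.1 hi'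
    rw [hmem] at hi hj
    simp only [Equiv.coe_toEmbedding, hx2] at hi
    exact lt_asymm hi hj
  have hcover : ∀ i, x i ≠ i → i ∈ S ∨ ∃ j ∈ S, i = x j := by
    intro i hi
    rcases lt_trichotomy (e i) (e (x i)) with h | h | h
    · exact Or.inl ((hmem i).2 h)
    · exact absurd (e.injective h).symm hi
    · exact Or.inr ⟨x i, (hmem _).2 (by rwa [hx2]), (hx2 i).symm⟩
  have hunion : movedIn x Finset.univ = S ∪ S.map x.toEmbedding := by
    ext i
    simp only [movedIn, Finset.mem_filter, Finset.mem_univ, true_and, Finset.mem_union,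
      Finset.mem_map, Equiv.coe_toEmbedding]
    constructor
    · intro hi
      rcases hcover i hi with h | ⟨j, hj, rfl⟩
      · exact Or.inl h
      · exact Or.inr ⟨j, hj, rfl⟩
    · rintro (h | ⟨j, hj, rfl⟩) heq
      · rw [hmem, heq] at h; exact lt_irrefl _ h
      · rw [hmem, ← x.injective heq] at hj
        rw [heq] at hj
        exact lt_irrefl _ hj
  rw [hunion, Finset.card_union_of_disjoint hdisj, Finset.card_map] at h16
  have h8 : S.card = 8 := by omega
  set f := (Finset.equivFinOfCardEq h8).symm
  refine ⟨fun t => (f t : P), fun s t h => f.injective (Subtype.ext h), ?_, ?_⟩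
  · intro s t h
    simp only at h
    exact Finset.disjoint_left.1 hdisj (f s).2 (by
      rw [h]; exact Finset.mem_map_of_mem x.toEmbedding (f t).2)
  · intro i hi
    rcases hcover i hi with h | ⟨j, hj, rfl⟩
    · exact ⟨f.symm ⟨i, h⟩, Or.inl (by simp)⟩
    · exact ⟨f.symm ⟨j, hj⟩, Or.inr (by simp)⟩

/-- An orthonormal basis of the `(-1)`-eigenspace consisting of multiples of projected basis
vectors. -/
lemma exists_antiProj_orthonormalBasis (hcard : Fintype.card P = 23) (hunit : ∀ i, ‖α i‖ = 1)
    (hangle : ∀ i j, i ≠ j → ⟪α i, α j⟫ = 1 / 5) (hT : ∀ i, T (α i) = α (x i))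
    (hx2 : ∀ i, x (x i) = i) (h16 : (movedIn x Finset.univ).card = 16) :
    ∃ (b : OrthonormalBasis (Fin 8) ℝ (Module.End.eigenspace T (-1))) (τ : Fin 8 → P),
      (∀ t, x (τ t) ≠ τ t) ∧ ∀ t, b t = (√5 * (√2)⁻¹) • antiProj T (α (τ t)) := by
  have hT1 := inner_map_map_of_permutes hcard hunit hangle hT
  have hT2 := map_map_of_permutes hcard hunit hangle hT hx2
  obtain ⟨τ, hinj, hτ, hcover⟩ := exists_transversal hx2 h16
  set g : Fin 8 → Module.End.eigenspace T (-1) :=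
    fun t => (√5 * (√2)⁻¹) • antiProj T (α (τ t)) with hg
  have h5 : (√5 * (√2)⁻¹) * (√5 * (√2)⁻¹) = (5 / 2 : ℝ) := by
    rw [mul_mul_mul_comm, inv_sqrt_two_mul_self, Real.mul_self_sqrt (by norm_num)]; norm_num
  have hne : (√5 * (√2)⁻¹) ≠ 0 := by intro h; rw [h] at h5; norm_num at h5
  -- Each projected α has squared norm (1 − 1/5)/2 = 2/5; for different 2-cycles both inner products
  -- are 1/5 and cancel.
  have hon : Orthonormal ℝ g := by
    rw [orthonormal_iff_ite]
    intro s t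
    simp only [hg]
    rw [inner_smul_smul_eigenspace, inner_antiProj hT1 hT2, hT, inner_eq_ite hunit hangle,
      inner_eq_ite hunit hangle,
      if_neg (hτ s t), h5]
    by_cases hst : s = t
    · simp [hst]; norm_num
    · rw [if_neg (fun h => hst (hinj h)), if_neg hst]; norm_num
  have hmem : ∀ i, antiProj T (α i) ∈ Submodule.span ℝ (Set.range g) := by
    intro i
    have hτm : ∀ t, antiProj T (α (τ t)) ∈ Submodule.span ℝ (Set.range g) := by
      intro t
      have h : antiProj T (α (τ t)) = (√5 * (√2)⁻¹)⁻¹ • g t := by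
        rw [hg, smul_smul, inv_mul_cancel₀ hne, one_smul]
      rw [h]
      exact Submodule.smul_mem _ _ (Submodule.subset_span ⟨t, rfl⟩)
    by_cases hi : x i = i
    · have h : antiProj T (α i) = 0 := by
        apply Subtype.ext
        rw [coe_antiProj hT1 hT2, hT, hi, sub_self, smul_zero]; rfl
      rw [h]
      exact Submodule.zero_mem _
    · obtain ⟨t, rfl | rfl⟩ := hcover i hi
      · exact hτm t
      · rw [← hT, antiProj_map hT1 hT2]
        exact Submodule.neg_mem _ (hτm t)
  have hsp : ⊤ ≤ Submodule.span ℝ (Set.range g) := by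
    rintro w -
    obtain ⟨c, hc⟩ := exists_eq_sum_smul hcard hunit hangle (w : R23)
    have h : w = antiProj T (w : R23) :=
      (Submodule.orthogonalProjectionOnto_mem_subspace_eq_self w).symm
    rw [h, hc]
    simp only [antiProj, map_sum, map_smul]
    exact Submodule.sum_mem _ fun i _ => Submodule.smul_mem _ _ (hmem i)
  refine ⟨OrthonormalBasis.mk hon hsp, τ, fun t => (hτ t t).symm, fun t => ?_⟩
  rw [OrthonormalBasis.coe_mk]

end Projection

/-! ### The projected vectors as E₈ roots. -/

section Roots

variable {P : Type*} [Fintype P] [DecidableEq P] {𝓑 : Finset (Finset P)} {α : P → R23}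
  {x : Equiv.Perm P} {T : R23 →ₗ[ℝ] R23}

lemma inner_antiProj_lineVector_self (hS : IsSteinerSystem 4 7 23 𝓑) (hunit : ∀ i, ‖α i‖ = 1)
    (hangle : ∀ i j, i ≠ j → ⟪α i, α j⟫ = 1 / 5) (hx : x ∈ blockAut 𝓑)
    (hx2 : ∀ i, x (x i) = i) (hx1 : ∃ i, x i ≠ i) (hT : ∀ i, T (α i) = α (x i))
    {s : P ⊕ 𝓑} (hs : lineAction hx s ≠ s) :
    ⟪antiProj T (lineVector 𝓑 α s), antiProj T (lineVector 𝓑 α s)⟫ = 2 / 5 := by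
  rw [inner_antiProj (inner_map_map_of_permutes hS.card_points hunit hangle hT)
    (map_map_of_permutes hS.card_points hunit hangle hT hx2), map_lineVector hx hT,
    inner_lineVector_lineAction hS hunit hangle hx hx2 hx1 hs, real_inner_self_eq_norm_sq,
    norm_lineVector hS hunit hangle]
  norm_num

lemma inner_lineVector_eq_odd (hS : IsSteinerSystem 4 7 23 𝓑) (hunit : ∀ i, ‖α i‖ = 1)
    (hangle : ∀ i j, i ≠ j → ⟪α i, α j⟫ = 1 / 5) (s t : P ⊕ 𝓑) :
    ∃ n : ℤ, ⟪lineVector 𝓑 α s, lineVector 𝓑 α t⟫ = (2 * n + 1) / 5 := by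
  by_cases hst : s = t
  · subst hst
    refine ⟨2, ?_⟩
    rw [real_inner_self_eq_norm_sq, norm_lineVector hS hunit hangle]; norm_num
  · rcases inner_lineVector hS hunit hangle hst with h | h
    · exact ⟨0, by rw [h]; norm_num⟩
    · exact ⟨-1, by rw [h]; norm_num⟩

/-- Half the difference of two odd multiples of 1/5 is an integer multiple of 1/5. -/
lemma inner_antiProj_lineVector_eq_int (hS : IsSteinerSystem 4 7 23 𝓑) (hunit : ∀ i, ‖α i‖ = 1)
    (hangle : ∀ i j, i ≠ j → ⟪α i, α j⟫ = 1 / 5) (hx : x ∈ blockAut 𝓑)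
    (hx2 : ∀ i, x (x i) = i) (hT : ∀ i, T (α i) = α (x i)) (s t : P ⊕ 𝓑) :
    ∃ n : ℤ, 5 * ⟪antiProj T (lineVector 𝓑 α s), antiProj T (lineVector 𝓑 α t)⟫ = n := by
  rw [inner_antiProj (inner_map_map_of_permutes hS.card_points hunit hangle hT)
    (map_map_of_permutes hS.card_points hunit hangle hT hx2), map_lineVector hx hT]
  obtain ⟨n, hn⟩ := inner_lineVector_eq_odd hS hunit hangle s t
  obtain ⟨m, hm⟩ := inner_lineVector_eq_odd hS hunit hangle s (lineAction hx t)
  refine ⟨n - m, ?_⟩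
  rw [hn, hm]; push_cast; ring

/-- If distinct u and v had equal projections, then 2/5 = (⟪u, v⟫ − ⟪u, Tv⟫)/2 ≤ (1/5 + 1/5)/2,
which is absurd. -/
lemma antiProj_lineVector_injOn (hS : IsSteinerSystem 4 7 23 𝓑) (hunit : ∀ i, ‖α i‖ = 1)
    (hangle : ∀ i j, i ≠ j → ⟪α i, α j⟫ = 1 / 5) (hx : x ∈ blockAut 𝓑)
    (hx2 : ∀ i, x (x i) = i) (hx1 : ∃ i, x i ≠ i) (hT : ∀ i, T (α i) = α (x i)) :
    Set.InjOn (fun s => antiProj T (lineVector 𝓑 α s)) {s | lineAction hx s ≠ s} := by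
  intro s hs t ht hst
  by_contra hne
  have h := inner_antiProj_lineVector_self hS hunit hangle hx hx2 hx1 hT hs
  simp only at hst
  nth_rw 2 [hst] at h
  rw [inner_antiProj (inner_map_map_of_permutes hS.card_points hunit hangle hT)
    (map_map_of_permutes hS.card_points hunit hangle hT hx2), map_lineVector hx hT] at h
  have h2 : -(1 / 5) ≤ ⟪lineVector 𝓑 α s, lineVector 𝓑 α (lineAction hx t)⟫ := by
    by_cases hst' : s = lineAction hx t
    · rw [← hst', real_inner_self_eq_norm_sq, norm_lineVector hS hunit hangle]; norm_num
    · rcases inner_lineVector hS hunit hangle hst' with h | h <;> rw [h]; norm_num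
  rcases inner_lineVector hS hunit hangle hne with h1 | h1 <;> linarith

lemma projectedMoved_lineVectors (hS : IsSteinerSystem 4 7 23 𝓑) (hunit : ∀ i, ‖α i‖ = 1)
    (hangle : ∀ i j, i ≠ j → ⟪α i, α j⟫ = 1 / 5) (hx : x ∈ blockAut 𝓑)
    (hT : ∀ i, T (α i) = α (x i)) :
    projectedMoved T (lineVectors 𝓑 α) =
      (fun s => antiProj T (lineVector 𝓑 α s)) '' {s | lineAction hx s ≠ s} := by
  rw [projectedMoved, ← range_lineVector]
  ext w
  constructor
  · rintro ⟨_, ⟨⟨s, rfl⟩, hs⟩, rfl⟩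
    rw [map_lineVector hx hT] at hs
    exact ⟨s, fun h => hs (by rw [h]), rfl⟩
  · rintro ⟨s, hs, rfl⟩
    refine ⟨lineVector 𝓑 α s, ⟨⟨s, rfl⟩, ?_⟩, rfl⟩
    rw [map_lineVector hx hT]
    exact fun h => hs (lineVector_injective hS hunit hangle h)

lemma ncard_lineAction_moved (hS : IsSteinerSystem 4 7 23 𝓑) (hx : x ∈ blockAut 𝓑)
    (hx2 : ∀ i, x (x i) = i) (hx1 : ∃ i, x i ≠ i) :
    {s : P ⊕ 𝓑 | lineAction hx s ≠ s}.ncard = 240 := by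
  rw [← card_lineAction_moved hS hx hx2 hx1, ← Set.ncard_coe_finset]
  congr 1
  ext s; simp

lemma ncard_projectedMoved (hS : IsSteinerSystem 4 7 23 𝓑) (hunit : ∀ i, ‖α i‖ = 1)
    (hangle : ∀ i j, i ≠ j → ⟪α i, α j⟫ = 1 / 5) (hx : x ∈ blockAut 𝓑)
    (hx2 : ∀ i, x (x i) = i) (hx1 : ∃ i, x i ≠ i) (hT : ∀ i, T (α i) = α (x i)) :
    (projectedMoved T (lineVectors 𝓑 α)).ncard = 240 := by
  rw [projectedMoved_lineVectors hS hunit hangle hx hT,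
    (antiProj_lineVector_injOn hS hunit hangle hx hx2 hx1 hT).ncard_image,
    ncard_lineAction_moved hS hx hx2 hx1]

/-- The projections of the moved line vectors are, up to a scalar, the minimal vectors of the
`E₈` lattice. -/
theorem exists_isometry_image_projectedMoved (hS : IsSteinerSystem 4 7 23 𝓑)
    (hunit : ∀ i, ‖α i‖ = 1) (hangle : ∀ i j, i ≠ j → ⟪α i, α j⟫ = 1 / 5) (hx : x ∈ blockAut 𝓑)
    (hx2 : ∀ i, x (x i) = i) (hx1 : ∃ i, x i ≠ i) (hT : ∀ i, T (α i) = α (x i)) :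
    ∃ φ : Module.End.eigenspace T (-1) ≃ₗᵢ[ℝ] R8,
      (fun w => φ (√5 • w)) '' projectedMoved T (lineVectors 𝓑 α) = minimalVectors latticeE8 := by
  obtain ⟨b, τ, hτ, hb⟩ := exists_antiProj_orthonormalBasis hS.card_points hunit hangle hT hx2
    (involution_structure hS hx hx2 hx1).1
  -- The factor √5 and the factor √5/√2 in `b` combine to 5/√2, so each coordinate is an integer
  -- over √2.
  have hcoord : ∀ s : P ⊕ 𝓑, ∃ a : Fin 8 → ℤ,
      b.repr (√5 • antiProj T (lineVector 𝓑 α s)) = intVector a := by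
    intro s
    choose a ha using fun t => inner_antiProj_lineVector_eq_int hS hunit hangle hx hx2 hT
      (Sum.inl (τ t)) s
    refine ⟨a, ?_⟩
    ext t
    rw [OrthonormalBasis.repr_apply_apply, hb, inner_smul_smul_eigenspace]
    change _ = (√2)⁻¹ * (a t : ℝ)
    rw [← ha]
    change _ = (√2)⁻¹ * (5 * ⟪antiProj T (α (τ t)), antiProj T (lineVector 𝓑 α s)⟫)
    have h5 : √5 * √5 = (5 : ℝ) := Real.mul_self_sqrt (by norm_num)
    linear_combination ((√2)⁻¹ * ⟪antiProj T (α (τ t)), antiProj T (lineVector 𝓑 α s)⟫) * h5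
  choose a ha using hcoord
  have hinner : ∀ s t, (1 / 2 : ℝ) * ((∑ i, a s i * a t i : ℤ) : ℝ) =
      5 * ⟪antiProj T (lineVector 𝓑 α s), antiProj T (lineVector 𝓑 α t)⟫ := by
    intro s t
    have h5 : √5 * √5 = (5 : ℝ) := Real.mul_self_sqrt (by norm_num)
    have h := b.repr.inner_map_map (√5 • antiProj T (lineVector 𝓑 α s))
      (√5 • antiProj T (lineVector 𝓑 α t))
    rw [ha, ha, inner_intVector, inner_smul_smul_eigenspace] at h
    rw [h, h5]
  set A : Finset (Fin 8 → ℤ) := (Finset.univ.filter fun s => lineAction hx s ≠ s).image a with hA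
  have hAcoe : (A : Set (Fin 8 → ℤ)) = a '' {s | lineAction hx s ≠ s} := by
    rw [hA]; ext; simp
  have hcardA : A.card = 240 := by
    rw [← Set.ncard_coe_finset, hAcoe, Set.InjOn.ncard_image,
      ncard_lineAction_moved hS hx hx2 hx1]
    intro s hs t ht hst
    apply antiProj_lineVector_injOn hS hunit hangle hx hx2 hx1 hT hs ht
    have h := ha s
    rw [hst, ← ha t] at h
    exact smul_right_injective _ (show √5 ≠ 0 by positivity) (b.repr.injective h)
  obtain ⟨σ, hσ⟩ := exists_perm_image_eq_hammingVectors A hcardA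
    (by
      intro v hv
      obtain ⟨s, hs, rfl⟩ := Finset.mem_image.1 hv
      have h := hinner s s
      rw [inner_antiProj_lineVector_self hS hunit hangle hx hx2 hx1 hT
        (Finset.mem_filter.1 hs).2] at h
      have : ((∑ i, a s i * a s i : ℤ) : ℝ) = 4 := by linarith
      simp only [sq]
      exact_mod_cast this)
    (by
      intro v hv w hw
      obtain ⟨s, _, rfl⟩ := Finset.mem_image.1 hv
      obtain ⟨t, _, rfl⟩ := Finset.mem_image.1 hw
      obtain ⟨n, hn⟩ := inner_antiProj_lineVector_eq_int hS hunit hangle hx hx2 hT s t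
      have h := hinner s t
      rw [hn] at h
      refine ⟨n, ?_⟩
      have : ((∑ i, a s i * a t i : ℤ) : ℝ) = n + n := by linarith
      exact_mod_cast this)
  -- Reindexing by `σ.symm` makes the i-th coordinate the old coordinate at `σ i`, matching a ∘ σ.
  refine ⟨(b.reindex σ.symm).repr.trans frameIsometry, ?_⟩
  rw [← image_hammingVectors, ← hσ, hAcoe, projectedMoved_lineVectors hS hunit hangle hx hT]
  simp only [Set.image_image]
  apply Set.image_congr
  intro s _
  rw [LinearIsometryEquiv.trans_apply]
  congr 1
  ext i
  rw [OrthonormalBasis.repr_reindex, ha]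
  rfl

end Roots

theorem mainTheorem7 {P : Type*} [Fintype P] [DecidableEq P]
    (𝓑 : Finset (Finset P)) (hS : IsSteinerSystem 4 7 23 𝓑)
    (α : P → R23) (hunit : ∀ i, ‖α i‖ = 1) (hangle : ∀ i j, i ≠ j → ⟪α i, α j⟫ = 1 / 5)
    (x : Equiv.Perm P) (hx : x ∈ blockAut 𝓑) (hinv : orderOf x = 2) :
    -- the vectors are 276 unit vectors spanning equiangular lines
    ((lineVectors 𝓑 α).ncard = 276 ∧ (∀ u ∈ lineVectors 𝓑 α, ‖u‖ = 1) ∧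
      (∀ u ∈ lineVectors 𝓑 α, ∀ v ∈ lineVectors 𝓑 α, u ≠ v → |⟪u, v⟫| = 1 / 5)) ∧
    -- `x` acts linearly through its permutation of the `αᵢ`
    (∃! T : R23 →ₗ[ℝ] R23, ∀ i, T (α i) = α (x i)) ∧
    ∀ T : R23 →ₗ[ℝ] R23, (∀ i, T (α i) = α (x i)) →
      T '' lineVectors 𝓑 α = lineVectors 𝓑 α ∧
      {u | u ∈ lineVectors 𝓑 α ∧ T u = u}.ncard = 36 ∧
      {u | u ∈ lineVectors 𝓑 α ∧ T u ≠ u}.ncard = 240 ∧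
      Module.finrank ℝ (Module.End.eigenspace T (-1)) = 8 ∧
      (projectedMoved T (lineVectors 𝓑 α)).ncard = 240 ∧
      (∃ c : ℝ, 0 < c ∧ ∃ φ : Module.End.eigenspace T (-1) ≃ₗᵢ[ℝ] R8,
        (fun w => φ (c • w)) '' projectedMoved T (lineVectors 𝓑 α) =
          minimalVectors latticeE8) := by
  have hx2 : ∀ i, x (x i) = i := fun i => by
    have h : x ^ 2 = 1 := hinv ▸ pow_orderOf_eq_one x
    rw [sq] at h
    exact Equiv.congr_fun h i
  have hx1 : ∃ i, x i ≠ i := by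
    by_contra! h
    have : x = 1 := Equiv.ext h
    rw [this, orderOf_one] at hinv
    norm_num at hinv
  have hinj := lineVector_injective hS hunit hangle
  refine ⟨⟨?_, ?_, ?_⟩, ?_, ?_⟩
  · rw [← range_lineVector, ← Set.image_univ, Set.ncard_image_of_injective _ hinj,
      Set.ncard_univ, Nat.card_eq_fintype_card, card_lineIndex hS]
  · rw [← range_lineVector]
    rintro _ ⟨s, rfl⟩
    exact norm_lineVector hS hunit hangle s
  · rw [← range_lineVector]
    rintro _ ⟨s, rfl⟩ _ ⟨t, rfl⟩ hne
    rcases inner_lineVector hS hunit hangle (fun h : s = t => hne (by rw [h])) with h | h <;>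
      rw [h] <;> norm_num [abs_of_pos]
  · set b := equiangularBasis hS.card_points hunit hangle
    have hb : ∀ i, b i = α i := equiangularBasis_apply hS.card_points hunit hangle
    refine ⟨b.constr ℝ (fun i => α (x i)), fun i => ?_, fun T hT => ?_⟩
    · rw [← hb, Module.Basis.constr_basis]
    · apply b.ext
      intro i
      rw [Module.Basis.constr_basis, hb, hT]
  · intro T hT
    have hmap := map_lineVector hx hT
    refine ⟨?_, ?_, ?_, ?_, ncard_projectedMoved hS hunit hangle hx hx2 hx1 hT, √5,
      by positivity, exists_isometry_image_projectedMoved hS hunit hangle hx hx2 hx1 hT⟩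
    · rw [← range_lineVector, ← Set.range_comp]
      apply Set.Subset.antisymm
      · rintro _ ⟨s, rfl⟩
        exact ⟨lineAction hx s, (hmap s).symm⟩
      · rintro _ ⟨s, rfl⟩
        refine ⟨lineAction hx s, ?_⟩
        rw [Function.comp_apply, hmap, lineAction_lineAction hx hx2]
    · have : {u | u ∈ lineVectors 𝓑 α ∧ T u = u} =
          lineVector 𝓑 α '' {s | lineAction hx s = s} := by
        rw [← range_lineVector]
        ext u
        constructor
        · rintro ⟨⟨s, rfl⟩, hs⟩
          rw [hmap] at hs
          exact ⟨s, hinj hs, rfl⟩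
        · rintro ⟨s, hs, rfl⟩
          exact ⟨⟨s, rfl⟩, by rw [hmap, hs]⟩
      rw [this, Set.ncard_image_of_injective _ hinj, ← card_lineAction_fixed hS hx hx2 hx1,
        ← Set.ncard_coe_finset]
      congr 1
      ext s; simp
    · have : {u | u ∈ lineVectors 𝓑 α ∧ T u ≠ u} =
          lineVector 𝓑 α '' {s | lineAction hx s ≠ s} := by
        rw [← range_lineVector]
        ext u
        constructor
        · rintro ⟨⟨s, rfl⟩, hs⟩
          rw [hmap] at hs
          exact ⟨s, fun h => hs (by rw [h]), rfl⟩
        · rintro ⟨s, hs, rfl⟩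
          exact ⟨⟨s, rfl⟩, by rw [hmap]; exact fun h => hs (hinj h)⟩
      rw [this, Set.ncard_image_of_injective _ hinj, ncard_lineAction_moved hS hx hx2 hx1]
    · obtain ⟨b, _⟩ := exists_antiProj_orthonormalBasis hS.card_points hunit hangle hT hx2
        (involution_structure hS hx hx2 hx1).1
      rw [Module.finrank_eq_card_basis b.toBasis, Fintype.card_fin]
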